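/- Let $n\ge 1$ and let $s=(s_1,\dots,s_n)\in(\mathbb{C}^\ast)^n$, $q,t\in\mathbb{C}^\ast$ with $|q|<1$ and $s_j/s_i\notin q^{\mathbb{Z}}$ for $1\le i<j\le n$. Put $z_0=px_1/x_n$ and $z_i=x_{i+1}/x_i$ $(1\le i\le n-1)$, so that $p=z_0z_1\cdots z_{n-1}$, $x_j/x_i=z_i\cdots z_{j-1}$ and $px_i/x_j=z_j\cdots z_{n-1}z_0\cdots z_{i-1}$ for $i<j$. With $\theta(z;p)=\prod_{m\ge0}(1-p^mz)(1-p^{m+1}/z)$, let $$\mathcal{B}_I(x;p)=\prod_{\substack{i<j\\ i\in I,\,j\notin I}}\frac{\theta(x_j/tx_i;p)}{\theta(x_j/x_i;p)}\prod_{\substack{i<j\\ i\notin I,\,j\in I}}\frac{\theta(tx_j/x_i;p)}{\theta(x_j/x_i;p)}\in\mathbb{C}[[z_0,\dots,z_{n-1}]],\qquad I\subseteq\{1,\dots,n\},$$ and let $$\mathcal{E}^{(r)}_{x,s}(p)=\sum_{|I|=r}\Big(\prod_{i\in I}s_i\Big)\,\mathcal{B}_I(x;p)\prod_{i\in I}T_{q,x_i}\qquad(r=1,\dots,n)$$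 be the modified elliptic Ruijsenaars operators, acting on $\mathbb{C}[[z_0,\dots,z_{n-1}]]$, where $T_{q,x_i}$ replaces $x_i$ by $qx_i$. A normalized formal solution consists of $f(x;s;p)=\sum_{k}f_{k_0,\dots,k_{n-1}}z_0^{k_0}\cdots z_{n-1}^{k_{n-1}}\in\mathbb{C}[[z_0,\dots,z_{n-1}]]$ and $\varepsilon^{(r)}(s;p)\in\mathbb{C}[[p]]$ $(r=1,\dots,n)$ such that $$\mathcal{E}^{(r)}_{x,s}(p)f(x;s;p)=\varepsilon^{(r)}(s;p)f(x;s;p)\quad(r=1,\dots,n),\qquad f_{m,\dots,m}=\delta_{m,0}\quad(m\ge0).$$ (1) There is a constant $\sigma\in(0,1)$, depending on $n,s,q,t$ but not on $p$, such that for the normalized formal solution, the series $f(x;s;p)$ converges absolutely for all $p\in\mathbb{C}$ with $|p|<\sigma^n$ and all $x\in(\mathbb{C}^\ast)^n$ with $$|px_1/x_n|<\sigma,\quad |x_2/x_1|<\sigma,\ \dots,\ |x_n/x_{n-1}|<\sigma,$$ and the series $\varepsilon^{(r)}(s;p)$ $(r=1,\dots,n)$ converge absolutely for $|p|<\sigma^n$.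 (2) The convergence is uniform on compact sets of parameters: for every compact set $K$ of parameters $(s,q,t)$ satisfying the above conditions there is $\sigma\in(0,1)$ such that, for every $\rho<\sigma$, the series of absolute values of the terms of $f(x;s;p)$ converges uniformly over $(s,q,t)\in K$, $p\in\mathbb{C}$ and $x\in(\mathbb{C}^\ast)^n$ with $|px_1/x_n|\le\rho$, $|x_{i+1}/x_i|\le\rho$ $(1\le i\le n-1)$; and, for every $\rho<\sigma^n$ and $r=1,\dots,n$, the series of absolute values of the terms of $\varepsilon^{(r)}(s;p)$ converges uniformly over $(s,q,t)\in K$ and $|p|\le\rho$. -/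

import Mathlib

noncomputable section

open scoped MvPowerSeries.WithPiTopology

/-!
Indexing: the position and spectral variables `x_1, …, x_n`, `s_1, …, s_n` are indexed by
`Fin n`, so that `x i` is `x_{i+1}`.  The variables `z_0 = p x_1 / x_n`, `z_1 = x_2 / x_1`, …,
`z_{n-1} = x_n / x_{n-1}` are indexed by `Fin n` as well, with `z_i = x i / x (i - 1)` for `i ≠ 0`.
Addition and subtraction in `Fin n` are cyclic.
-/

namespace Ruijsenaars

/-- The ring `ℂ⟦p x_1/x_n, x_2/x_1, …, x_n/x_{n-1}⟧` of formal power series in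
`z_0, …, z_{n-1}`. -/
abbrev Series (n : ℕ) : Type := MvPowerSeries (Fin n) ℂ

/-- The nome `p = z_0 z_1 ⋯ z_{n-1}` as an element of the ring of formal power series. -/
def nome (n : ℕ) : Series n := ∏ l : Fin n, MvPowerSeries.X l

/-- For `i < j`, the ratio `x j / x i = z_{i+1} ⋯ z_j`. -/
def ratio {n : ℕ} (i j : Fin n) : Series n :=
  ∏ l ∈ Finset.Ioc i j, MvPowerSeries.X l

/-- For `i < j`, the ratio `p x i / x j`, which is the product of the remaining variables. -/
def coratio {n : ℕ} (i j : Fin n) : Series n :=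
  ∏ l ∈ (Finset.Ioc i j)ᶜ, MvPowerSeries.X l

/-- The infinite shifted factorial `(a; p)_∞ = ∏_{m ≥ 0} (1 - p ^ m a)`, where `p` is the
nome. -/
def qPochhammer {n : ℕ} (a : Series n) : Series n :=
  ∏' m : ℕ, (1 - nome n ^ m * a)

/-- The infinite product that defines `qPochhammer` converges. -/
theorem multipliable_qPochhammer {n : ℕ} [NeZero n] (a : Series n) :
    Multipliable fun m : ℕ => (1 - nome n ^ m * a) := by
  have hc : MvPowerSeries.constantCoeff (nome n) = 0 := by
    rw [nome, map_prod]
    exact Finset.prod_eq_zero (Finset.mem_univ (0 : Fin n)) (by simp)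
  have h1 : (1 : ℕ∞) ≤ (nome n).order := by
    rw [Order.one_le_iff_pos, pos_iff_ne_zero]
    intro h
    exact MvPowerSeries.order_ne_zero_iff_constCoeff_eq_zero.2 hc h
  have h2 : ∀ m : ℕ, (m : ℕ∞) ≤ (-(nome n ^ m * a)).order := by
    intro m
    rw [MvPowerSeries.order_neg]
    calc (m : ℕ∞) ≤ m • (nome n).order := by
          rw [nsmul_eq_mul]; exact le_mul_of_one_le_right (zero_le) h1
      _ ≤ (nome n ^ m).order := MvPowerSeries.le_order_pow m
      _ ≤ (nome n ^ m).order + a.order := le_self_add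
      _ ≤ _ := MvPowerSeries.le_order_mul
  simp_rw [sub_eq_add_neg]
  apply MvPowerSeries.WithPiTopology.multipliable_one_add_of_tendsto_order_atTop_nhds_top
  refine tendsto_of_tendsto_of_tendsto_of_le_of_le ?_ tendsto_const_nhds h2 (fun _ => le_top)
  exact ENat.tendsto_nhds_top_iff_natCast_lt.2 fun k =>
    Filter.eventually_atTop.2 ⟨k + 1, fun b hb => by exact_mod_cast hb⟩

/-- The theta function `θ(c x j / x i; p) = (c x j / x i; p)_∞ (c⁻¹ p x i / x j; p)_∞`
for `i < j` and a nonzero constant `c`, as a formal power series. -/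
def theta {n : ℕ} (c : ℂ) (i j : Fin n) : Series n :=
  qPochhammer (MvPowerSeries.C c * ratio i j) * qPochhammer (MvPowerSeries.C c⁻¹ * coratio i j)

/-- The coefficient `B_I(x; p)` of the modified elliptic Ruijsenaars operators. The denominators
are formal power series with constant term `1`. -/
def coeffB {n : ℕ} (t : ℂ) (I : Finset (Fin n)) : Series n :=
  (∏ ij : Fin n × Fin n with ij.1 < ij.2 ∧ ij.1 ∈ I ∧ ij.2 ∉ I,
      theta t⁻¹ ij.1 ij.2 * (theta 1 ij.1 ij.2)⁻¹) *
    ∏ ij : Fin n × Fin n with ij.1 < ij.2 ∧ ij.1 ∉ I ∧ ij.2 ∈ I,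
      theta t ij.1 ij.2 * (theta 1 ij.1 ij.2)⁻¹

/-- The `q`-shift operator `∏_{i ∈ I} T_{q, x i}`.  Replacing `x i` by `q x i` multiplies
`z_i` by `q` and `z_{i+1}` by `q⁻¹`, so that the monomial `z ^ k` is multiplied by
`q ^ (k_i - k_{i+1})`. -/
def qShift {n : ℕ} [NeZero n] (q : ℂ) (I : Finset (Fin n)) (f : Series n) : Series n :=
  fun k => (∏ i ∈ I, q ^ ((k i : ℤ) - (k (i + 1) : ℤ))) * MvPowerSeries.coeff k f

/-- The modified elliptic Ruijsenaars operator of order `r`,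
`∑_{|I| = r} s^I B_I(x; p) T_{q,x}^I`. -/
def modifiedOperator {n : ℕ} [NeZero n] (s : Fin n → ℂ) (q t : ℂ) (r : ℕ) (f : Series n) :
    Series n :=
  ∑ I : Finset (Fin n) with I.card = r,
    MvPowerSeries.C (∏ i ∈ I, s i) * coeffB t I * qShift q I f

/-- A formal power series in `p`, regarded as a formal power series in the variables `z` through
`p = z_0 z_1 ⋯ z_{n-1}`. -/
def ofNome {n : ℕ} [NeZero n] (e : PowerSeries ℂ) : Series n :=
  fun k => if ∀ i, k i = k 0 then PowerSeries.coeff (k 0) e else 0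

/-- `f` is a normalized formal solution of the joint eigenvalue problem for the modified elliptic
Ruijsenaars operators, with formal eigenvalues `ε 1, …, ε n`.  Normalized means that the constant
term of `f` with respect to `x` (the sum over `m` of `p ^ m` times the coefficient of
`(z_0 ⋯ z_{n-1}) ^ m`) is `1`. -/
structure IsNormalizedFormalSolution {n : ℕ} [NeZero n] (s : Fin n → ℂ) (q t : ℂ)
    (f : Series n) (ε : ℕ → PowerSeries ℂ) : Prop where
  eigen : ∀ r ∈ Finset.Icc 1 n, modifiedOperator s q t r f = ofNome (ε r) * f
  normalized : ∀ m : ℕ,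
    MvPowerSeries.coeff (Finsupp.equivFunOnFinite.symm fun _ : Fin n => m) f
      = if m = 0 then 1 else 0

/-- The parameters `(s, q, t)` with `s_i, q, t` nonzero, `|q| < 1` and
`s_j / s_i ∉ q ^ ℤ` for `i < j`. -/
def parameterDomain (n : ℕ) : Set ((Fin n → ℂ) × ℂ × ℂ) :=
  {P | (∀ i, P.1 i ≠ 0) ∧ P.2.1 ≠ 0 ∧ ‖P.2.1‖ < 1 ∧ P.2.2 ≠ 0 ∧
    ∀ i j, i < j → ∀ m : ℤ, P.1 j / P.1 i ≠ P.2.1 ^ m}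

/-- The values `z_0 = p x_1 / x_n`, `z_1 = x_2 / x_1`, …, `z_{n-1} = x_n / x_{n-1}`. -/
def zValue {n : ℕ} [NeZero n] (p : ℂ) (x : Fin n → ℂ) (i : Fin n) : ℂ :=
  (if i = 0 then p else 1) * x i / x (i - 1)

/-- The term of `f(x; p)` with exponent `k`. -/
def term {n : ℕ} [NeZero n] (f : Series n) (p : ℂ) (x : Fin n → ℂ) (k : Fin n →₀ ℕ) : ℂ :=
  MvPowerSeries.coeff k f * ∏ i, zValue p x i ^ k i

end Ruijsenaars

end

/-! The proof is the method of majorants, applied to the recursion for the coefficients `f_k`. Put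
`μ_i = k_i - k_{i+1}` (cyclically). Since every `B_I` has constant term 1, the coefficient of `z^k`
in the `r`-th equation is `∑_{|I|=r} s^I (∏_{i∈I} q^{μ_i} - 1) f_k` plus terms controlled by
coefficients of lower degree. Weighting by `(-u)^r` and summing over `r` produces `(∏ (1 - u s_i
q^{μ_i}) - ∏ (1 - u s_i)) f_k`. The choice `u = 1/s_j` with `μ_j ≠ 0` kills the second product, and
genericity bounds the first below by a constant times `L = ∏ max(1, |q|^{μ_i})`. If all `μ_i`
vanish, the normalization gives `f_k`.

The `q`-shifts in the lower terms are at most `L` times a power of `|q|⁻¹` that only depends on the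
degree taken from `B_I` (`norm_shiftFactor_le`), so `L` cancels and there are no small divisors. On
diagonal exponents the same equations bound `ε^{(r)} - e_r(s)`. This gives `|f| ≤ 1 + C (M|f| +
M|f|²)` coefficientwise, where `M` has no constant term (`ParameterBounds.norm_coeff_le`). For a
small weight `w`, induction on the truncation degree yields a weighted `ℓ¹` norm of at most 2
(`exists_coeff_bounds`). The constants depend only on bounds that compactness supplies
(`exists_parameterBounds`), hence uniformity. -/

noncomputable section

open scoped MvPowerSeries.WithPiTopology

namespace Ruijsenaars

/-! ### Truncated weighted `ℓ¹` norms of formal power series -/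

section WeightedNorm

variable {n : ℕ} {𝕜 : Type*} [NormedField 𝕜]

/-- The exponents of total degree at most `N`. -/
def exponents (n N : ℕ) : Finset (Fin n →₀ ℕ) :=
  (Finsupp.finite_of_degree_le (σ := Fin n) N).toFinset

theorem mem_exponents {N : ℕ} {k : Fin n →₀ ℕ} : k ∈ exponents n N ↔ k.degree ≤ N := by
  simp [exponents]

/-- The weighted `ℓ¹` norm of the part of degree at most `N` of a formal power series. -/
def wnorm (w : ℝ) (N : ℕ) (g : MvPowerSeries (Fin n) 𝕜) : ℝ :=
  ∑ k ∈ exponents n N, ‖MvPowerSeries.coeff k g‖ * w ^ k.degree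

theorem wnorm_nonneg {w : ℝ} (hw : 0 ≤ w) (N : ℕ) (g : MvPowerSeries (Fin n) 𝕜) :
    0 ≤ wnorm w N g :=
  Finset.sum_nonneg fun _ _ => by positivity

theorem wnorm_add_le {w : ℝ} (hw : 0 ≤ w) (N : ℕ) (g h : MvPowerSeries (Fin n) 𝕜) :
    wnorm w N (g + h) ≤ wnorm w N g + wnorm w N h := by
  rw [wnorm, wnorm, wnorm, ← Finset.sum_add_distrib]
  refine Finset.sum_le_sum fun k _ => ?_
  rw [← add_mul, map_add]
  gcongr
  exact norm_add_le _ _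

theorem wnorm_neg (w : ℝ) (N : ℕ) (g : MvPowerSeries (Fin n) 𝕜) :
    wnorm w N (-g) = wnorm w N g := by
  simp [wnorm]

theorem wnorm_monomial_le {w : ℝ} (hw : 0 ≤ w) (N : ℕ) (d : Fin n →₀ ℕ) (c : 𝕜) :
    wnorm w N (MvPowerSeries.monomial d c) ≤ ‖c‖ * w ^ d.degree := by
  classical
  have h : ∀ k ∈ exponents n N, ‖MvPowerSeries.coeff k (MvPowerSeries.monomial d c)‖ * w ^ k.degree
      = if k = d then ‖c‖ * w ^ d.degree else 0 := by
    intro k _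
    rw [MvPowerSeries.coeff_monomial]
    split_ifs with h
    · rw [h]
    · simp
  rw [wnorm, Finset.sum_congr rfl h, Finset.sum_ite_eq']
  split_ifs
  · exact le_rfl
  · positivity

theorem wnorm_C_le {w : ℝ} (hw : 0 ≤ w) (N : ℕ) (c : 𝕜) :
    wnorm w N (MvPowerSeries.C c : MvPowerSeries (Fin n) 𝕜) ≤ ‖c‖ := by
  rw [← MvPowerSeries.monomial_zero_eq_C_apply]
  simpa using wnorm_monomial_le hw N (0 : Fin n →₀ ℕ) c

theorem wnorm_one_le {w : ℝ} (hw : 0 ≤ w) (N : ℕ) :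
    wnorm w N (1 : MvPowerSeries (Fin n) 𝕜) ≤ 1 := by
  simpa using wnorm_C_le (n := n) hw N (1 : 𝕜)

theorem wnorm_X_le {w : ℝ} (hw : 0 ≤ w) (N : ℕ) (l : Fin n) :
    wnorm w N (MvPowerSeries.X l : MvPowerSeries (Fin n) 𝕜) ≤ w := by
  simpa [MvPowerSeries.X_def, Finsupp.degree_single] using
    wnorm_monomial_le hw N (Finsupp.single l 1) (1 : 𝕜)

/-- A nonzero contribution takes degree at least `a` from `g`, which leaves at most `N` for `h`.
With `a = 1` this gain of one degree drives the final induction. -/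
theorem wnorm_mul_le_of_coeff_eq_zero {w : ℝ} (hw : 0 ≤ w) (N a : ℕ)
    (g h : MvPowerSeries (Fin n) 𝕜)
    (hg : ∀ k : Fin n →₀ ℕ, k.degree < a → MvPowerSeries.coeff k g = 0) :
    wnorm w (N + a) (g * h) ≤ wnorm w (N + a) g * wnorm w N h := by
  classical
  let φ : (Fin n →₀ ℕ) × (Fin n →₀ ℕ) → ℝ := fun p =>
    (‖MvPowerSeries.coeff p.1 g‖ * w ^ p.1.degree) * (‖MvPowerSeries.coeff p.2 h‖ * w ^ p.2.degree)
  have hφ : ∀ p, 0 ≤ φ p := fun p => by positivity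
  let Q := exponents n (N + a) ×ˢ exponents n N
  have h1 : ∀ k ∈ exponents n (N + a),
      ‖MvPowerSeries.coeff k (g * h)‖ * w ^ k.degree ≤ ∑ p ∈ Q with p.1 + p.2 = k, φ p := by
    intro k hk
    rw [MvPowerSeries.coeff_mul]
    calc ‖∑ p ∈ Finset.HasAntidiagonal.antidiagonal k,
          MvPowerSeries.coeff p.1 g * MvPowerSeries.coeff p.2 h‖ * w ^ k.degree
        ≤ (∑ p ∈ Finset.HasAntidiagonal.antidiagonal k,
          ‖MvPowerSeries.coeff p.1 g * MvPowerSeries.coeff p.2 h‖) * w ^ k.degree := by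
          gcongr; exact norm_sum_le _ _
      _ = ∑ p ∈ Finset.HasAntidiagonal.antidiagonal k, φ p := by
          rw [Finset.sum_mul]
          refine Finset.sum_congr rfl fun p hp => ?_
          rw [← Finset.HasAntidiagonal.mem_antidiagonal.1 hp, map_add, pow_add, norm_mul]
          simp only [φ]; ring
      _ = ∑ p ∈ Finset.HasAntidiagonal.antidiagonal k with φ p ≠ 0, φ p :=
          (Finset.sum_filter_ne_zero _).symm
      _ ≤ _ := by
          refine Finset.sum_le_sum_of_subset_of_nonneg ?_ fun p _ _ => hφ p
          intro p hp
          obtain ⟨hp, hp0⟩ := Finset.mem_filter.1 hp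
          have hpk := Finset.HasAntidiagonal.mem_antidiagonal.1 hp
          have hd : a ≤ p.1.degree := by
            by_contra hlt
            exact hp0 (by simp [φ, hg p.1 (not_le.1 hlt)])
          have hk' := mem_exponents.1 hk
          rw [← hpk, map_add] at hk'
          refine Finset.mem_filter.2 ⟨Finset.mem_product.2 ⟨mem_exponents.2 ?_,
            mem_exponents.2 ?_⟩, hpk⟩ <;> omega
  calc wnorm w (N + a) (g * h) ≤ ∑ k ∈ exponents n (N + a), ∑ p ∈ Q with p.1 + p.2 = k, φ p :=
        Finset.sum_le_sum h1
    _ ≤ ∑ p ∈ Q, φ p := by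
        refine Finset.sum_fiberwise_le_sum_of_sum_fiber_nonneg fun k _ => ?_
        exact Finset.sum_nonneg fun p _ => hφ p
    _ = _ := by rw [wnorm, wnorm, Finset.sum_mul_sum, Finset.sum_product]

theorem wnorm_mul_le {w : ℝ} (hw : 0 ≤ w) (N : ℕ) (g h : MvPowerSeries (Fin n) 𝕜) :
    wnorm w N (g * h) ≤ wnorm w N g * wnorm w N h :=
  wnorm_mul_le_of_coeff_eq_zero hw N 0 g h (by simp)

theorem wnorm_succ_mul_le {w : ℝ} (hw : 0 ≤ w) (N : ℕ) (g h : MvPowerSeries (Fin n) 𝕜)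
    (hg : MvPowerSeries.coeff 0 g = 0) :
    wnorm w (N + 1) (g * h) ≤ wnorm w (N + 1) g * wnorm w N h :=
  wnorm_mul_le_of_coeff_eq_zero hw N 1 g h fun k hk => by
    rwa [(Finsupp.degree_eq_zero_iff k).1 (by omega)]

theorem wnorm_prod_le {w : ℝ} (hw : 0 ≤ w) (N : ℕ) {ι : Type*} (S : Finset ι)
    (g : ι → MvPowerSeries (Fin n) 𝕜) {M : ι → ℝ} (hM : ∀ i ∈ S, wnorm w N (g i) ≤ M i) :
    wnorm w N (∏ i ∈ S, g i) ≤ ∏ i ∈ S, M i := by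
  classical
  induction S using Finset.induction_on with
  | empty => simpa using wnorm_one_le hw N
  | insert i S hi ih =>
    rw [Finset.prod_insert hi, Finset.prod_insert hi]
    have h1 := hM i (Finset.mem_insert_self i S)
    have h2 := ih fun j hj => hM j (Finset.mem_insert_of_mem hj)
    exact (wnorm_mul_le hw N _ _).trans
      (mul_le_mul h1 h2 (wnorm_nonneg hw N _) ((wnorm_nonneg hw N _).trans h1))

/-- A consequence of `1 + x ≤ exp x`. The bound only sees the sum of the norms, so it survives the
passage to infinite products. -/
theorem wnorm_prod_one_sub_sub_one_le {w : ℝ} (hw : 0 ≤ w) (N : ℕ) {ι : Type*} (S : Finset ι)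
    (a : ι → MvPowerSeries (Fin n) 𝕜) :
    wnorm w N (∏ i ∈ S, (1 - a i) - 1) ≤ Real.exp (∑ i ∈ S, wnorm w N (a i)) - 1 := by
  classical
  induction S using Finset.induction_on with
  | empty => simp [wnorm]
  | insert i S hi ih =>
    rw [Finset.prod_insert hi, Finset.sum_insert hi, Real.exp_add]
    set g := ∏ i ∈ S, (1 - a i)
    set y := Real.exp (∑ i ∈ S, wnorm w N (a i))
    have e : (1 - a i) * g - 1 = (1 + -a i) * (g - 1) + -a i := by ring
    have h1 := wnorm_add_le hw N ((1 + -a i) * (g - 1)) (-a i)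
    have h2 := wnorm_mul_le hw N (1 + -a i) (g - 1)
    have h3 := wnorm_add_le hw N 1 (-a i)
    have h4 := wnorm_one_le (n := n) (𝕜 := 𝕜) hw N
    rw [wnorm_neg] at h1 h3
    have h5 := Real.add_one_le_exp (wnorm w N (a i))
    have h6 := wnorm_nonneg hw N (g - 1)
    have h7 := wnorm_nonneg hw N (a i)
    have h8 : wnorm w N (1 + -a i) * wnorm w N (g - 1) ≤ (1 + wnorm w N (a i)) * (y - 1) := by
      exact mul_le_mul (by linarith) ih h6 (by linarith)
    rw [e]
    have h9 : 0 < y := Real.exp_pos _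
    nlinarith

/-- Since `g' = 1 - (g - 1) g'`, the norm of `g'` is at most 1 plus half of itself; truncation makes
it finite, so it can be absorbed. -/
theorem wnorm_le_of_one_sub_mul {w : ℝ} (hw : 0 ≤ w) (N : ℕ) {g g' : MvPowerSeries (Fin n) 𝕜}
    (hg : g * g' = 1) (h : wnorm w N (g - 1) ≤ 1 / 2) : wnorm w N g' ≤ 2 := by
  have e : g' = 1 + -((g - 1) * g') := by rw [sub_mul, hg]; ring
  have h1 := wnorm_add_le hw N 1 (-((g - 1) * g'))
  rw [← e, wnorm_neg] at h1
  have h2 := wnorm_mul_le hw N (g - 1) g'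
  have h3 := wnorm_one_le (n := n) (𝕜 := 𝕜) hw N
  have h4 := mul_le_mul_of_nonneg_right h (wnorm_nonneg hw N g')
  linarith

/-- Only finitely many coefficients enter, so coefficientwise limits preserve the bounds. -/
theorem continuous_wnorm (w : ℝ) (N : ℕ) :
    Continuous (wnorm w N : MvPowerSeries (Fin n) 𝕜 → ℝ) := by
  unfold wnorm
  refine continuous_finsetSum _ fun k _ => ?_
  exact ((MvPowerSeries.WithPiTopology.continuous_coeff 𝕜 k).norm).mul continuous_const

end WeightedNorm

/-! ### Uniform bounds for the theta functions and the coefficients `B_I` -/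

section Theta

variable {n : ℕ} [NeZero n]

theorem wnorm_qPochhammer_sub_one_le {w : ℝ} (hw : 0 ≤ w) (hw' : w ≤ 1 / 2) (N : ℕ)
    (a : Series n) :
    wnorm w N (qPochhammer a - 1) ≤ Real.exp (2 * wnorm w N a) - 1 := by
  have hlim := (multipliable_qPochhammer a).hasProd
  have h1 : Filter.Tendsto (fun S : Finset ℕ => wnorm w N (∏ m ∈ S, (1 - nome n ^ m * a) - 1))
      Filter.atTop (nhds (wnorm w N (qPochhammer a - 1))) :=
    ((continuous_wnorm w N).tendsto _).comp
      (Filter.Tendsto.sub_const (by simpa [HasProd, qPochhammer] using hlim) 1)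
  refine le_of_tendsto' h1 fun S => (wnorm_prod_one_sub_sub_one_le hw N S _).trans ?_
  gcongr
  have hnome : wnorm w N (nome n) ≤ w := by
    refine (wnorm_prod_le hw N _ _ fun l _ => wnorm_X_le hw N l).trans ?_
    rw [Finset.prod_const, Finset.card_univ, Fintype.card_fin]
    exact pow_le_of_le_one hw (by linarith) (NeZero.ne n)
  have hm : ∀ m : ℕ, wnorm w N (nome n ^ m * a) ≤ (1 / 2) ^ m * wnorm w N a := by
    intro m
    refine (wnorm_mul_le hw N _ _).trans ?_
    gcongr
    · exact wnorm_nonneg hw N a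
    · have := wnorm_prod_le hw N (Finset.range m) (fun _ => nome n) (M := fun _ => 1 / 2)
        fun _ _ => hnome.trans hw'
      simpa using this
  calc ∑ m ∈ S, wnorm w N (nome n ^ m * a) ≤ ∑ m ∈ S, (1 / 2) ^ m * wnorm w N a :=
        Finset.sum_le_sum fun m _ => hm m
    _ = (∑ m ∈ S, (1 / 2 : ℝ) ^ m) * wnorm w N a := by rw [Finset.sum_mul]
    _ ≤ 2 * wnorm w N a := by
        gcongr
        · exact wnorm_nonneg hw N a
        · exact (summable_geometric_two.sum_le_tsum S fun _ _ => by positivity).trans_eq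
            tsum_geometric_two

theorem wnorm_prod_X_le {n : ℕ} {w : ℝ} (hw : 0 ≤ w) (hw' : w ≤ 1 / 2) (N : ℕ) {S : Finset (Fin n)}
    (hS : S.Nonempty) : wnorm w N (∏ l ∈ S, MvPowerSeries.X l : Series n) ≤ w := by
  refine (wnorm_prod_le hw N _ _ fun l _ => wnorm_X_le hw N l).trans ?_
  rw [Finset.prod_const]
  exact pow_le_of_le_one hw (by linarith) (Finset.card_pos.2 hS).ne'

theorem wnorm_theta_sub_one_le {w A : ℝ} (hw : 0 ≤ w) (hA : 1 ≤ A) (hwA : 16 * A * w ≤ 1) (N : ℕ)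
    {c : ℂ} (hc : ‖c‖ ≤ A) (hc' : ‖c⁻¹‖ ≤ A) {i j : Fin n} (hij : i < j) :
    wnorm w N (theta c i j - 1) ≤ 1 / 2 := by
  have hw' : w ≤ 1 / 2 := by nlinarith
  have key : ∀ (b : ℂ) (S : Finset (Fin n)), ‖b‖ ≤ A → S.Nonempty →
      wnorm w N (qPochhammer (MvPowerSeries.C b * ∏ l ∈ S, MvPowerSeries.X l) - 1) ≤ 1 / 7 := by
    intro b S hb hS
    refine (wnorm_qPochhammer_sub_one_le hw hw' N _).trans ?_
    have h1 : wnorm w N (MvPowerSeries.C b * ∏ l ∈ S, MvPowerSeries.X l) ≤ 1 / 16 := by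
      refine (wnorm_mul_le hw N _ _).trans ?_
      calc _ ≤ A * w := mul_le_mul ((wnorm_C_le hw N b).trans hb) (wnorm_prod_X_le hw hw' N hS)
            (wnorm_nonneg hw N _) (by linarith)
        _ ≤ _ := by linarith
    have h2 : Real.exp (2 * wnorm w N (MvPowerSeries.C b * ∏ l ∈ S, MvPowerSeries.X l)) ≤
        Real.exp (1 / 8) := Real.exp_le_exp.2 (by linarith)
    have h3 := Real.add_one_le_exp (-(1 / 8) : ℝ)
    rw [Real.exp_neg] at h3
    have h4 := Real.exp_pos (1 / 8)
    -- Obtained by inverting `exp (-1/8) ≥ 7/8`.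
    have h5 : Real.exp (1 / 8) ≤ 8 / 7 := by
      have h6 := mul_le_mul_of_nonneg_left h3 h4.le
      rw [mul_inv_cancel₀ h4.ne'] at h6
      linarith
    linarith
  have h1 := key c (Finset.Ioc i j) hc ⟨j, Finset.mem_Ioc.2 ⟨hij, le_rfl⟩⟩
  -- The half-open interval omits `i`, so the complementary product is not empty either.
  have h2 := key c⁻¹ (Finset.Ioc i j)ᶜ hc' ⟨i, by simp⟩
  rw [theta, ratio, coratio]
  set g := qPochhammer (MvPowerSeries.C c * ∏ l ∈ Finset.Ioc i j, MvPowerSeries.X l)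
  set h := qPochhammer (MvPowerSeries.C c⁻¹ * ∏ l ∈ (Finset.Ioc i j)ᶜ, MvPowerSeries.X l)
  have e : g * h - 1 = (g - 1) * (h - 1) + ((g - 1) + (h - 1)) := by ring
  rw [e]
  have h3 := wnorm_add_le hw N ((g - 1) * (h - 1)) ((g - 1) + (h - 1))
  have h4 := wnorm_add_le hw N (g - 1) (h - 1)
  have h5 := wnorm_mul_le hw N (g - 1) (h - 1)
  have h6 := mul_le_mul h1 h2 (wnorm_nonneg hw N _) (by norm_num)
  linarith

theorem constantCoeff_qPochhammer (a : Series n) (ha : MvPowerSeries.constantCoeff a = 0) :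
    MvPowerSeries.constantCoeff (qPochhammer a) = 1 := by
  rw [qPochhammer, Multipliable.map_tprod (multipliable_qPochhammer a) MvPowerSeries.constantCoeff
    (MvPowerSeries.WithPiTopology.continuous_constantCoeff ℂ)]
  simp [ha]

theorem constantCoeff_theta (c : ℂ) {i j : Fin n} (hij : i < j) :
    MvPowerSeries.constantCoeff (theta c i j) = 1 := by
  have key : ∀ (b : ℂ) (S : Finset (Fin n)), S.Nonempty →
      MvPowerSeries.constantCoeff (MvPowerSeries.C b * ∏ l ∈ S, MvPowerSeries.X l) = 0 := by
    rintro b S ⟨l, hl⟩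
    rw [map_mul, map_prod, Finset.prod_eq_zero hl (by simp), mul_zero]
  rw [theta, map_mul, ratio, coratio,
    constantCoeff_qPochhammer _ (key _ _ ⟨j, Finset.mem_Ioc.2 ⟨hij, le_rfl⟩⟩),
    constantCoeff_qPochhammer _ (key _ _ ⟨i, by simp⟩), mul_one]

theorem wnorm_theta_div_le {w A : ℝ} (hw : 0 ≤ w) (hA : 1 ≤ A) (hwA : 16 * A * w ≤ 1) (N : ℕ)
    {c : ℂ} (hc : ‖c‖ ≤ A) (hc' : ‖c⁻¹‖ ≤ A) {i j : Fin n} (hij : i < j) :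
    wnorm w N (theta c i j * (theta 1 i j)⁻¹) ≤ 4 := by
  have h1 := wnorm_theta_sub_one_le hw hA hwA N hc hc' hij
  have h2 := wnorm_theta_sub_one_le hw hA hwA N (c := 1) (by simpa) (by simpa) hij
  have h3 : wnorm w N (theta 1 i j)⁻¹ ≤ 2 :=
    wnorm_le_of_one_sub_mul hw N (MvPowerSeries.mul_inv_cancel _
      (by rw [constantCoeff_theta _ hij]; exact one_ne_zero)) h2
  have h4 := wnorm_add_le hw N 1 (theta c i j - 1)
  have h5 := wnorm_one_le (n := n) (𝕜 := ℂ) hw N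
  rw [add_sub_cancel] at h4
  calc _ ≤ wnorm w N (theta c i j) * wnorm w N (theta 1 i j)⁻¹ := wnorm_mul_le hw N _ _
    _ ≤ 2 * 2 := mul_le_mul (by linarith) h3 (wnorm_nonneg hw N _) (by norm_num)
    _ = 4 := by norm_num

theorem wnorm_coeffB_le {w A : ℝ} (hw : 0 ≤ w) (hA : 1 ≤ A) (hwA : 16 * A * w ≤ 1) (N : ℕ)
    {t : ℂ} (ht : ‖t‖ ≤ A) (ht' : ‖t⁻¹‖ ≤ A) (I : Finset (Fin n)) :
    wnorm w N (coeffB t I) ≤ 4 ^ (n * n) * 4 ^ (n * n) := by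
  have key : ∀ (c : ℂ) (S : Finset (Fin n × Fin n)), ‖c‖ ≤ A → ‖c⁻¹‖ ≤ A →
      (∀ ij ∈ S, ij.1 < ij.2) →
      wnorm w N (∏ ij ∈ S, theta c ij.1 ij.2 * (theta 1 ij.1 ij.2)⁻¹) ≤ 4 ^ (n * n) := by
    intro c S hc hc' hS
    refine (wnorm_prod_le hw N S _ fun ij hij =>
      wnorm_theta_div_le hw hA hwA N hc hc' (hS ij hij)).trans ?_
    rw [Finset.prod_const]
    refine pow_le_pow_right₀ (by norm_num) ((Finset.card_le_univ S).trans ?_)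
    simp
  refine (wnorm_mul_le hw N _ _).trans (mul_le_mul ?_ ?_ (wnorm_nonneg hw N _) (by positivity))
  · exact key t⁻¹ _ ht' (by rwa [inv_inv]) fun ij hij => (Finset.mem_filter.1 hij).2.1
  · exact key t _ ht ht' fun ij hij => (Finset.mem_filter.1 hij).2.1

theorem constantCoeff_coeffB (t : ℂ) (I : Finset (Fin n)) :
    MvPowerSeries.constantCoeff (coeffB t I) = 1 := by
  have key : ∀ (c : ℂ) (S : Finset (Fin n × Fin n)), (∀ ij ∈ S, ij.1 < ij.2) →
      MvPowerSeries.constantCoeff (∏ ij ∈ S, theta c ij.1 ij.2 * (theta 1 ij.1 ij.2)⁻¹) = 1 := by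
    intro c S hS
    rw [map_prod]
    refine Finset.prod_eq_one fun ij hij => ?_
    rw [map_mul, MvPowerSeries.constantCoeff_inv, constantCoeff_theta _ (hS ij hij),
      constantCoeff_theta _ (hS ij hij)]
    simp
  rw [coeffB, map_mul, key _ _ fun ij hij => (Finset.mem_filter.1 hij).2.1,
    key _ _ fun ij hij => (Finset.mem_filter.1 hij).2.1, mul_one]

end Theta

/-! ### Coefficientwise majorants -/

section Majorant

variable {n : ℕ}

/-- The series of the absolute values of the coefficients. -/
def absSeries (f : Series n) : MvPowerSeries (Fin n) ℝ := fun k => ‖MvPowerSeries.coeff k f‖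

theorem coeff_absSeries (f : Series n) (k : Fin n →₀ ℕ) :
    MvPowerSeries.coeff k (absSeries f) = ‖MvPowerSeries.coeff k f‖ := rfl

theorem coeff_absSeries_nonneg (f : Series n) (k : Fin n →₀ ℕ) :
    0 ≤ MvPowerSeries.coeff k (absSeries f) := by
  rw [coeff_absSeries]
  exact norm_nonneg _

theorem wnorm_absSeries (w : ℝ) (N : ℕ) (f : Series n) :
    wnorm w N (absSeries f) = wnorm w N f := by
  simp [wnorm, coeff_absSeries]

theorem norm_coeff_mul_le_coeff_mul {g f : Series n} {a b : MvPowerSeries (Fin n) ℝ}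
    (hg : ∀ k, ‖MvPowerSeries.coeff k g‖ ≤ MvPowerSeries.coeff k a)
    (hf : ∀ k, ‖MvPowerSeries.coeff k f‖ ≤ MvPowerSeries.coeff k b) (k : Fin n →₀ ℕ) :
    ‖MvPowerSeries.coeff k (g * f)‖ ≤ MvPowerSeries.coeff k (a * b) := by
  classical
  rw [MvPowerSeries.coeff_mul, MvPowerSeries.coeff_mul]
  refine (norm_sum_le _ _).trans (Finset.sum_le_sum fun p _ => ?_)
  rw [norm_mul]
  exact mul_le_mul (hg _) (hf _) (norm_nonneg _) ((norm_nonneg _).trans (hg _))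

theorem coeff_mul_nonneg {a b : MvPowerSeries (Fin n) ℝ} (ha : ∀ k, 0 ≤ MvPowerSeries.coeff k a)
    (hb : ∀ k, 0 ≤ MvPowerSeries.coeff k b) (k : Fin n →₀ ℕ) :
    0 ≤ MvPowerSeries.coeff k (a * b) := by
  classical
  rw [MvPowerSeries.coeff_mul]
  exact Finset.sum_nonneg fun p _ => mul_nonneg (ha _) (hb _)

end Majorant

/-! ### The recursion for the coefficients and its a priori bound -/

section Solution

variable {n : ℕ} [NeZero n]

/-- The eigenvalue of the `q`-shift operator on the monomial `z ^ k`. -/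
def shiftFactor (q : ℂ) (I : Finset (Fin n)) (k : Fin n →₀ ℕ) : ℂ :=
  ∏ i ∈ I, q ^ ((k i : ℤ) - (k (i + 1) : ℤ))

theorem coeff_qShift (q : ℂ) (I : Finset (Fin n)) (f : Series n) (k : Fin n →₀ ℕ) :
    MvPowerSeries.coeff k (qShift q I f) = shiftFactor q I k * MvPowerSeries.coeff k f := rfl

theorem shiftFactor_add {q : ℂ} (hq : q ≠ 0) (I : Finset (Fin n)) (d l : Fin n →₀ ℕ) :
    shiftFactor q I (d + l) = shiftFactor q I d * shiftFactor q I l := by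
  rw [shiftFactor, shiftFactor, shiftFactor, ← Finset.prod_mul_distrib]
  refine Finset.prod_congr rfl fun i _ => ?_
  rw [← zpow_add₀ hq]
  congr 1
  simp only [Finsupp.add_apply]
  push_cast
  ring

theorem shiftFactor_of_const (q : ℂ) (I : Finset (Fin n)) {k : Fin n →₀ ℕ}
    (hk : ∀ i, k i = k 0) : shiftFactor q I k = 1 :=
  Finset.prod_eq_one fun i _ => by simp [hk i, hk (i + 1)]

/-- Each exponent `d_i - d_{i+1}` is at most `d_i`, and `|q| < 1`. -/
theorem pow_degree_le_norm_shiftFactor {q : ℂ} (hq : q ≠ 0) (hq1 : ‖q‖ < 1) (I : Finset (Fin n))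
    (d : Fin n →₀ ℕ) : ‖q‖ ^ d.degree ≤ ‖shiftFactor q I d‖ := by
  have hq0 : 0 < ‖q‖ := norm_pos_iff.2 hq
  rw [Finsupp.degree_eq_sum, ← Finset.prod_pow_eq_pow_sum, shiftFactor, norm_prod]
  calc ∏ i, ‖q‖ ^ d i ≤ ∏ i ∈ I, ‖q‖ ^ d i := by
        rw [← Finset.prod_mul_prod_compl I]
        exact mul_le_of_le_one_right (by positivity)
          (Finset.prod_le_one (fun _ _ => by positivity) fun i _ => pow_le_one₀ hq0.le hq1.le)
    _ ≤ _ := by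
        refine Finset.prod_le_prod (fun _ _ => by positivity) fun i _ => ?_
        rw [norm_zpow, ← zpow_natCast]
        exact zpow_le_zpow_right_of_le_one₀ hq0 hq1.le (by omega)

/-- This trades the shift at the lower exponent `l` for the shift at the target `d + l`, which the
denominator of the recursion controls. The cost depends on `d` alone and goes into `majorantB`. -/
theorem norm_shiftFactor_le {q : ℂ} (hq : q ≠ 0) (hq1 : ‖q‖ < 1) (I : Finset (Fin n))
    (d l : Fin n →₀ ℕ) :
    ‖shiftFactor q I l‖ ≤ ‖shiftFactor q I (d + l)‖ * ‖q‖⁻¹ ^ d.degree := by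
  have hq0 : 0 < ‖q‖ := norm_pos_iff.2 hq
  rw [shiftFactor_add hq, norm_mul, inv_pow, ← div_eq_mul_inv, le_div_iff₀ (by positivity),
    mul_comm]
  gcongr
  exact pow_degree_le_norm_shiftFactor hq hq1 I d

theorem norm_shiftFactor_le_prod_max (q : ℂ) (I : Finset (Fin n)) (k : Fin n →₀ ℕ) :
    ‖shiftFactor q I k‖ ≤ ∏ i, max 1 (‖q‖ ^ ((k i : ℤ) - (k (i + 1) : ℤ))) := by
  rw [shiftFactor, norm_prod, ← Finset.prod_mul_prod_compl I]
  refine (Finset.prod_le_prod (fun _ _ => norm_nonneg _) fun i _ => ?_).trans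
    (le_mul_of_one_le_right (Finset.prod_nonneg fun _ _ => by positivity)
      (Finset.one_le_prod fun i _ => le_max_left _ _))
  rw [norm_zpow]
  exact le_max_right _ _

/-- A common majorant of the nonconstant parts of the coefficients `B_I`, which also accounts for
the growth of the `q`-shifts. -/
def majorantB (s : Fin n → ℂ) (q t : ℂ) : MvPowerSeries (Fin n) ℝ := fun d =>
  ∑ I : Finset (Fin n),
    ‖∏ i ∈ I, s i‖ * ‖MvPowerSeries.coeff d (coeffB t I - 1)‖ * ‖q‖⁻¹ ^ d.degree

theorem coeff_majorantB {n : ℕ} (s : Fin n → ℂ) (q t : ℂ) (d : Fin n →₀ ℕ) :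
    MvPowerSeries.coeff d (majorantB s q t) = ∑ I : Finset (Fin n),
      ‖∏ i ∈ I, s i‖ * ‖MvPowerSeries.coeff d (coeffB t I - 1)‖ * ‖q‖⁻¹ ^ d.degree := rfl

theorem coeff_majorantB_nonneg {n : ℕ} (s : Fin n → ℂ) (q t : ℂ) (d : Fin n →₀ ℕ) :
    0 ≤ MvPowerSeries.coeff d (majorantB s q t) := by
  rw [coeff_majorantB]
  positivity

theorem coeff_zero_coeffB_sub_one (t : ℂ) (I : Finset (Fin n)) :
    MvPowerSeries.coeff 0 (coeffB t I - 1) = 0 := by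
  simp [constantCoeff_coeffB]

theorem coeff_zero_majorantB (s : Fin n → ℂ) (q t : ℂ) :
    MvPowerSeries.coeff 0 (majorantB s q t) = 0 := by
  simp only [coeff_majorantB, coeff_zero_coeffB_sub_one]
  simp

/-- A majorant of the lower order part of the modified Ruijsenaars operators applied to `f`. -/
def lowerMajorant (s : Fin n → ℂ) (q t : ℂ) (f : Series n) : MvPowerSeries (Fin n) ℝ :=
  majorantB s q t * absSeries f

theorem coeff_lowerMajorant_nonneg {n : ℕ} (s : Fin n → ℂ) (q t : ℂ) (f : Series n)
    (k : Fin n →₀ ℕ) : 0 ≤ MvPowerSeries.coeff k (lowerMajorant s q t f) :=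
  coeff_mul_nonneg (coeff_majorantB_nonneg s q t) (coeff_absSeries_nonneg f) k

theorem coeff_zero_lowerMajorant (s : Fin n → ℂ) (q t : ℂ) (f : Series n) :
    MvPowerSeries.coeff 0 (lowerMajorant s q t f) = 0 := by
  have h := coeff_zero_majorantB s q t
  rw [MvPowerSeries.coeff_zero_eq_constantCoeff_apply] at h ⊢
  rw [lowerMajorant, map_mul, h, zero_mul]

theorem sum_norm_coeff_lower_le {q : ℂ} (hq : q ≠ 0) (hq1 : ‖q‖ < 1) (s : Fin n → ℂ) (t : ℂ)
    (f : Series n) (k : Fin n →₀ ℕ) {L : ℝ} (hL : ∀ I, ‖shiftFactor q I k‖ ≤ L)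
    (U : Finset (Finset (Fin n))) :
    ∑ I ∈ U, ‖(∏ i ∈ I, s i) * MvPowerSeries.coeff k ((coeffB t I - 1) * qShift q I f)‖
      ≤ L * MvPowerSeries.coeff k (lowerMajorant s q t f) := by
  classical
  refine (Finset.sum_le_sum_of_subset_of_nonneg (Finset.subset_univ U)
    fun _ _ _ => norm_nonneg _).trans ?_
  rw [lowerMajorant, MvPowerSeries.coeff_mul, Finset.mul_sum]
  simp only [coeff_majorantB, coeff_absSeries, Finset.sum_mul, Finset.mul_sum]
  rw [Finset.sum_comm]
  refine Finset.sum_le_sum fun I _ => ?_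
  rw [MvPowerSeries.coeff_mul, Finset.mul_sum]
  refine (norm_sum_le _ _).trans (Finset.sum_le_sum fun p hp => ?_)
  rw [coeff_qShift, norm_mul, norm_mul, norm_mul]
  have h1 := norm_shiftFactor_le hq hq1 I p.1 p.2
  rw [Finset.HasAntidiagonal.mem_antidiagonal.1 hp] at h1
  have h2 : ‖shiftFactor q I p.2‖ ≤ L * ‖q‖⁻¹ ^ p.1.degree :=
    h1.trans (mul_le_mul_of_nonneg_right (hL I) (by positivity))
  calc _ ≤ ‖∏ i ∈ I, s i‖ * (‖MvPowerSeries.coeff p.1 (coeffB t I - 1)‖ *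
        ((L * ‖q‖⁻¹ ^ p.1.degree) * ‖MvPowerSeries.coeff p.2 f‖)) := by gcongr
    _ = _ := by ring

theorem coeff_modifiedOperator (s : Fin n → ℂ) (q t : ℂ) (r : ℕ) (f : Series n)
    (k : Fin n →₀ ℕ) :
    MvPowerSeries.coeff k (modifiedOperator s q t r f) =
      ∑ I : Finset (Fin n) with I.card = r, (∏ i ∈ I, s i) *
        (shiftFactor q I k * MvPowerSeries.coeff k f +
          MvPowerSeries.coeff k ((coeffB t I - 1) * qShift q I f)) := by
  rw [modifiedOperator, map_sum]
  refine Finset.sum_congr rfl fun I _ => ?_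
  rw [mul_assoc, MvPowerSeries.coeff_C_mul, sub_mul, one_mul, map_sub, coeff_qShift]
  ring

theorem exists_mu_ne_zero {k : Fin n →₀ ℕ} (hk : ¬∀ i, k i = k 0) :
    ∃ j, (k j : ℤ) - (k (j + 1) : ℤ) ≠ 0 := by
  by_contra! h
  refine hk fun i => ?_
  have h1 : ∀ m : ℕ, k (Fin.ofNat n m) = k 0 := by
    intro m
    induction m with
    | zero => simp
    | succ m ih =>
      have h2 := h (Fin.ofNat n m)
      -- Both sides are read modulo `n`, so the step also holds where the index wraps around.
      have h3 : Fin.ofNat n m + 1 = Fin.ofNat n (m + 1) := by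
        ext; simp [Fin.val_add]
      rw [h3] at h2
      omega
  simpa using h1 i

namespace IsNormalizedFormalSolution

variable {s : Fin n → ℂ} {q t : ℂ} {f : Series n} {ε : ℕ → PowerSeries ℂ}

theorem coeff_of_const (H : IsNormalizedFormalSolution s q t f ε) {k : Fin n →₀ ℕ}
    (hk : ∀ i, k i = k 0) : MvPowerSeries.coeff k f = if k = 0 then 1 else 0 := by
  have h1 : k = Finsupp.equivFunOnFinite.symm fun _ : Fin n => k 0 := by
    ext i; simpa using hk i
  have h2 : k = 0 ↔ k 0 = 0 := by
    refine ⟨fun h => by simp [h], fun h => ?_⟩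
    ext i; simpa [h] using hk i
  rw [h1, H.normalized, ← h1]
  simp [h2]

/-- The eigenvalue is supported on diagonal exponents, so at a diagonal `k` the other factor is
diagonal as well, where the normalization leaves only the constant term of `f`. -/
theorem coeff_eigenvalue (H : IsNormalizedFormalSolution s q t f ε) {r : ℕ}
    (hr : r ∈ Finset.Icc 1 n) {k : Fin n →₀ ℕ} (hk : ∀ i, k i = k 0) :
    MvPowerSeries.coeff k (ofNome (ε r) : Series n) =
      MvPowerSeries.coeff k (modifiedOperator s q t r f) := by
  classical
  rw [H.eigen r hr, MvPowerSeries.coeff_mul, Finset.sum_eq_single (k, 0)]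
  · rw [H.coeff_of_const (k := 0) (by simp)]
    simp
  · rintro ⟨d, l⟩ hp hne
    have hdl : d + l = k := Finset.HasAntidiagonal.mem_antidiagonal.1 hp
    by_cases hd : ∀ i, d i = d 0
    · have hl : ∀ i, l i = l 0 := by
        intro i
        have h1 := DFunLike.congr_fun hdl i
        have h2 := DFunLike.congr_fun hdl 0
        simp only [Finsupp.add_apply] at h1 h2
        have h3 := hk i
        have h4 := hd i
        omega
      have hl0 : l ≠ 0 := by
        rintro rfl
        exact hne (by rw [← hdl, add_zero])
      rw [H.coeff_of_const hl, if_neg hl0, mul_zero]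
    · have : MvPowerSeries.coeff d (ofNome (ε r) : Series n) = 0 := if_neg hd
      rw [this, zero_mul]
  · intro h
    exact absurd (Finset.HasAntidiagonal.mem_antidiagonal.2 (add_zero k)) h

/-- On the diagonal all shift factors are 1, so the constant terms of the `B_I` contribute exactly
`e_r(s)`, at `k = 0`; the rest is lower order. -/
theorem norm_coeff_eigenvalue_sub_le (H : IsNormalizedFormalSolution s q t f ε) (hq : q ≠ 0)
    (hq1 : ‖q‖ < 1) {r : ℕ} (hr : r ∈ Finset.Icc 1 n) (k : Fin n →₀ ℕ) :
    ‖MvPowerSeries.coeff k ((ofNome (ε r) : Series n) -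
      MvPowerSeries.C (∑ I : Finset (Fin n) with I.card = r, ∏ i ∈ I, s i))‖ ≤
      MvPowerSeries.coeff k (lowerMajorant s q t f) := by
  classical
  rw [map_sub, MvPowerSeries.coeff_C]
  by_cases hk : ∀ i, k i = k 0
  · rw [H.coeff_eigenvalue hr hk, coeff_modifiedOperator]
    have h1 := sum_norm_coeff_lower_le hq hq1 s t f k (L := 1)
      (fun I => by rw [shiftFactor_of_const q I hk, norm_one])
      (Finset.univ.filter fun I : Finset (Fin n) => I.card = r)
    rw [one_mul] at h1
    refine le_trans (le_of_eq ?_) ((norm_sum_le _ _).trans h1)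
    congr 1
    simp only [shiftFactor_of_const q _ hk, H.coeff_of_const hk, mul_add, Finset.sum_add_distrib]
    split_ifs <;> simp
  · have h1 : MvPowerSeries.coeff k (ofNome (ε r) : Series n) = 0 := if_neg hk
    have h2 : k ≠ 0 := by rintro rfl; simp at hk
    rw [h1, if_neg h2, sub_zero, norm_zero]
    exact coeff_lowerMajorant_nonneg s q t f k

/-- For `r ≥ 1` the sum is the coefficient of `(ε^{(r)} - e_r(s)) f`. The trivial case `r = 0` is
included so that a generating sum over all subsets can be formed. -/
theorem norm_sum_card_le (H : IsNormalizedFormalSolution s q t f ε) (hq : q ≠ 0)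
    (hq1 : ‖q‖ < 1) {r : ℕ} (hr : r ≤ n) (k : Fin n →₀ ℕ) :
    ‖∑ I : Finset (Fin n) with I.card = r, (∏ i ∈ I, s i) *
        ((shiftFactor q I k - 1) * MvPowerSeries.coeff k f +
          MvPowerSeries.coeff k ((coeffB t I - 1) * qShift q I f))‖ ≤
      MvPowerSeries.coeff k (lowerMajorant s q t f * absSeries f) := by
  rcases Nat.eq_zero_or_pos r with rfl | hr0
  · have h1 : coeffB (n := n) t ∅ = 1 := by simp [coeffB]
    have h2 : ∑ I : Finset (Fin n) with I.card = 0, (∏ i ∈ I, s i) *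
        ((shiftFactor q I k - 1) * MvPowerSeries.coeff k f +
          MvPowerSeries.coeff k ((coeffB t I - 1) * qShift q I f)) = 0 := by
      refine Finset.sum_eq_zero fun I hI => ?_
      have hI : I = ∅ := by simpa using hI
      simp [hI, h1, shiftFactor]
    rw [h2, norm_zero]
    exact coeff_mul_nonneg (coeff_lowerMajorant_nonneg s q t f) (coeff_absSeries_nonneg f) k
  · have hr' : r ∈ Finset.Icc 1 n := Finset.mem_Icc.2 ⟨hr0, hr⟩
    have h1 := norm_coeff_mul_le_coeff_mul (H.norm_coeff_eigenvalue_sub_le hq hq1 hr')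
      (f := f) (b := absSeries f) (fun _ => le_rfl) k
    refine le_trans (le_of_eq ?_) h1
    congr 1
    rw [sub_mul, map_sub, ← H.eigen r hr', MvPowerSeries.coeff_C_mul, coeff_modifiedOperator,
      Finset.sum_mul, ← Finset.sum_sub_distrib]
    refine Finset.sum_congr rfl fun I _ => ?_
    ring

end IsNormalizedFormalSolution

/-- Quantitative nondegeneracy of the parameters `(s, q, t)`. -/
structure ParameterBounds (A c : ℝ) (s : Fin n → ℂ) (q t : ℂ) : Prop where
  q_ne_zero : q ≠ 0
  norm_q_lt_one : ‖q‖ < 1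
  norm_q_inv_le : ‖q‖⁻¹ ≤ A
  s_ne_zero : ∀ i, s i ≠ 0
  norm_s_le : ∀ i, ‖s i‖ ≤ A
  norm_s_inv_le : ∀ i, ‖(s i)⁻¹‖ ≤ A
  norm_t_le : ‖t‖ ≤ A
  norm_t_inv_le : ‖t⁻¹‖ ≤ A
  le_norm_one_sub : ∀ (i j : Fin n) (m : ℤ), (i = j → m ≠ 0) →
    c * max 1 (‖q‖ ^ m) ≤ ‖1 - s i / s j * q ^ m‖

namespace ParameterBounds

variable {A c : ℝ} {s : Fin n → ℂ} {q t : ℂ}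

theorem norm_prod_s_le {n : ℕ} {A c : ℝ} {s : Fin n → ℂ} {q t : ℂ}
    (hP : ParameterBounds A c s q t) (hA : 1 ≤ A) (I : Finset (Fin n)) : ‖∏ i ∈ I, s i‖ ≤ A ^ n := by
  rw [norm_prod]
  calc ∏ i ∈ I, ‖s i‖ ≤ ∏ i ∈ I, A :=
        Finset.prod_le_prod (fun _ _ => norm_nonneg _) fun i _ => hP.norm_s_le i
    _ = A ^ I.card := Finset.prod_const _
    _ ≤ A ^ n := pow_le_pow_right₀ hA (card_finset_fin_le I)

/-- The weight `w = lam w₀ / A` absorbs the powers of `|q|⁻¹ ≤ A`. As there is no constant term,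
each monomial also gains at least one factor `lam`, which makes the norm small. -/
theorem wnorm_majorantB_le (hP : ParameterBounds A c s q t) (hA : 1 ≤ A) {w₀ lam w : ℝ}
    (hw₀ : 0 ≤ w₀) (hw₀A : 16 * A * w₀ ≤ 1) (hl : 0 ≤ lam) (hl1 : lam ≤ 1)
    (hw : A * w = lam * w₀) (N : ℕ) :
    wnorm w N (majorantB s q t) ≤ 2 ^ n * (A ^ n * (lam * (4 ^ (n * n) * 4 ^ (n * n)))) := by
  have hA0 : 0 < A := by linarith
  have hw' : 0 ≤ w := by
    by_contra h
    have : A * w < 0 := mul_neg_of_pos_of_neg hA0 (not_le.1 h)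
    have : 0 ≤ lam * w₀ := by positivity
    linarith
  have key : ∀ I : Finset (Fin n), ∀ d : Fin n →₀ ℕ,
      ‖∏ i ∈ I, s i‖ * ‖MvPowerSeries.coeff d (coeffB t I - 1)‖ * ‖q‖⁻¹ ^ d.degree
        * w ^ d.degree ≤
          A ^ n * (lam * (‖MvPowerSeries.coeff d (coeffB t I)‖ * w₀ ^ d.degree)) := by
    intro I d
    by_cases hd : d = 0
    · rw [hd, coeff_zero_coeffB_sub_one]
      simp only [norm_zero, mul_zero, zero_mul]
      positivity
    · have h1 : MvPowerSeries.coeff d (coeffB t I - 1) = MvPowerSeries.coeff d (coeffB t I) := by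
        classical
        rw [map_sub, MvPowerSeries.coeff_one, if_neg hd, sub_zero]
      have h2 : d.degree ≠ 0 := fun h => hd ((Finsupp.degree_eq_zero_iff d).1 h)
      have h3 : ‖q‖⁻¹ ^ d.degree * w ^ d.degree ≤ lam * w₀ ^ d.degree := by
        rw [← mul_pow]
        calc (‖q‖⁻¹ * w) ^ d.degree ≤ (A * w) ^ d.degree := by
              have := hP.norm_q_inv_le
              gcongr
          _ = lam ^ d.degree * w₀ ^ d.degree := by rw [hw, mul_pow]
          _ ≤ lam * w₀ ^ d.degree := by
              gcongr
              exact pow_le_of_le_one hl hl1 h2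
      rw [h1]
      calc _ = ‖∏ i ∈ I, s i‖ * (‖MvPowerSeries.coeff d (coeffB t I)‖ *
            (‖q‖⁻¹ ^ d.degree * w ^ d.degree)) := by ring
        _ ≤ A ^ n * (‖MvPowerSeries.coeff d (coeffB t I)‖ * (lam * w₀ ^ d.degree)) := by
            have := hP.norm_prod_s_le hA I
            gcongr
        _ = _ := by ring
  calc wnorm w N (majorantB s q t)
      ≤ ∑ d ∈ exponents n N, ∑ I : Finset (Fin n),
          A ^ n * (lam * (‖MvPowerSeries.coeff d (coeffB t I)‖ * w₀ ^ d.degree)) := by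
        refine Finset.sum_le_sum fun d _ => ?_
        rw [Real.norm_of_nonneg (coeff_majorantB_nonneg s q t d), coeff_majorantB, Finset.sum_mul]
        exact Finset.sum_le_sum fun I _ => key I d
    _ = ∑ I : Finset (Fin n), A ^ n * (lam * wnorm w₀ N (coeffB t I)) := by
        rw [Finset.sum_comm]
        simp only [← Finset.mul_sum, wnorm]
    _ ≤ ∑ I : Finset (Fin n), A ^ n * (lam * (4 ^ (n * n) * 4 ^ (n * n))) := by
        refine Finset.sum_le_sum fun I _ => ?_
        have := wnorm_coeffB_le hw₀ hA hw₀A N hP.norm_t_le hP.norm_t_inv_le I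
        gcongr
    _ = _ := by
        rw [Finset.sum_const, Finset.card_univ, Fintype.card_finset, Fintype.card_fin, nsmul_eq_mul]
        push_cast
        ring

/-- The `n` equations are combined through the generating function of the elementary symmetric
polynomials, evaluated at `u = 1/s_j`. -/
theorem norm_coeff_le (hP : ParameterBounds A c s q t) (hA : 1 ≤ A) (hc : 0 < c) {f : Series n}
    {ε : ℕ → PowerSeries ℂ} (H : IsNormalizedFormalSolution s q t f ε) {k : Fin n →₀ ℕ}
    (hk0 : k ≠ 0) :
    ‖MvPowerSeries.coeff k f‖ ≤ (n + 1) * A ^ n / c ^ n *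
      (MvPowerSeries.coeff k (lowerMajorant s q t f) +
        MvPowerSeries.coeff k (lowerMajorant s q t f * absSeries f)) := by
  have hA0 : 0 < A := by linarith
  set h₁ := MvPowerSeries.coeff k (lowerMajorant s q t f)
  set h₂ := MvPowerSeries.coeff k (lowerMajorant s q t f * absSeries f)
  have hh₁ : 0 ≤ h₁ := coeff_lowerMajorant_nonneg s q t f k
  have hh₂ : 0 ≤ h₂ :=
    coeff_mul_nonneg (coeff_lowerMajorant_nonneg s q t f) (coeff_absSeries_nonneg f) k
  by_cases hk : ∀ i, k i = k 0
  · rw [H.coeff_of_const hk, if_neg hk0, norm_zero]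
    positivity
  obtain ⟨j, hj⟩ := exists_mu_ne_zero hk
  set u : ℂ := (s j)⁻¹
  set L : ℝ := ∏ i, max 1 (‖q‖ ^ ((k i : ℤ) - (k (i + 1) : ℤ))) with hLdef
  have hL1 : 1 ≤ L := Finset.one_le_prod fun i _ => le_max_left _ _
  have hL : ∀ I, ‖shiftFactor q I k‖ ≤ L := fun I => norm_shiftFactor_le_prod_max q I k
  let R : Finset (Fin n) → ℂ := fun I =>
    MvPowerSeries.coeff k ((coeffB t I - 1) * qShift q I f)
  let ψ : ℕ → ℂ := fun r => ∑ I : Finset (Fin n) with I.card = r, (∏ i ∈ I, s i) *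
    ((shiftFactor q I k - 1) * MvPowerSeries.coeff k f + R I)
  have hu : ∀ r ≤ n, ‖(-u) ^ r‖ ≤ A ^ n := by
    intro r hr
    rw [norm_pow, norm_neg]
    exact (pow_le_pow_left₀ (norm_nonneg _) (hP.norm_s_inv_le j) r).trans
      (pow_le_pow_right₀ hA hr)
  have expand : ∀ v : Fin n → ℂ, ∏ i, (1 - u * s i * v i) =
      ∑ I : Finset (Fin n), (-u) ^ I.card * ((∏ i ∈ I, s i) * ∏ i ∈ I, v i) := by
    intro v
    have e : ∀ i, 1 - u * s i * v i = 1 + -u * (s i * v i) := fun i => by ring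
    simp only [e]
    rw [Finset.prod_one_add, Finset.powerset_univ]
    refine Finset.sum_congr rfl fun I _ => ?_
    rw [Finset.prod_mul_distrib, Finset.prod_mul_distrib, Finset.prod_const]
  have hzero : ∏ i, (1 - u * s i * 1) = 0 :=
    Finset.prod_eq_zero (Finset.mem_univ j) (by simp [u, hP.s_ne_zero j])
  have hfib : ∑ r ∈ Finset.range (n + 1), (-u) ^ r * ψ r = ∑ I : Finset (Fin n),
      (-u) ^ I.card * ((∏ i ∈ I, s i) *
        ((shiftFactor q I k - 1) * MvPowerSeries.coeff k f + R I)) := by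
    rw [← Finset.sum_fiberwise_of_maps_to (s := Finset.univ) (t := Finset.range (n + 1))
      (g := Finset.card) fun I _ => Finset.mem_range.2 (Nat.lt_succ_of_le (card_finset_fin_le I))]
    refine Finset.sum_congr rfl fun r _ => ?_
    rw [Finset.mul_sum]
    refine Finset.sum_congr rfl fun I hI => ?_
    rw [(Finset.mem_filter.1 hI).2]
  have hmain : (∏ i, (1 - u * s i * q ^ ((k i : ℤ) - (k (i + 1) : ℤ)))) * MvPowerSeries.coeff k f =
      ∑ r ∈ Finset.range (n + 1), (-u) ^ r * ψ r -
        ∑ I : Finset (Fin n), (-u) ^ I.card * ((∏ i ∈ I, s i) * R I) := by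
    rw [← sub_zero (∏ i, _), ← hzero, expand, expand fun _ => 1, hfib, ← Finset.sum_sub_distrib,
      ← Finset.sum_sub_distrib, Finset.sum_mul]
    refine Finset.sum_congr rfl fun I _ => ?_
    rw [Finset.prod_const_one, shiftFactor]
    ring
  have hψ : ‖∑ r ∈ Finset.range (n + 1), (-u) ^ r * ψ r‖ ≤ (n + 1) * (A ^ n * h₂) := by
    refine (norm_sum_le_of_le (n := fun _ => A ^ n * h₂) _ fun r hr => ?_).trans (by simp)
    have hr := Nat.lt_succ_iff.1 (Finset.mem_range.1 hr)
    rw [norm_mul]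
    exact mul_le_mul (hu r hr) (H.norm_sum_card_le hP.q_ne_zero hP.norm_q_lt_one hr k)
      (norm_nonneg _) (by positivity)
  have hR : ‖∑ I : Finset (Fin n), (-u) ^ I.card * ((∏ i ∈ I, s i) * R I)‖ ≤ A ^ n * (L * h₁) := by
    refine (norm_sum_le_of_le (n := fun I => A ^ n * ‖(∏ i ∈ I, s i) * R I‖) _
      fun I _ => ?_).trans ?_
    · rw [norm_mul]
      exact mul_le_mul_of_nonneg_right (hu _ (card_finset_fin_le I)) (norm_nonneg _)
    · rw [← Finset.mul_sum]
      exact mul_le_mul_of_nonneg_left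
        (sum_norm_coeff_lower_le hP.q_ne_zero hP.norm_q_lt_one s t f k hL Finset.univ)
        (by positivity)
  -- The factor `i = j` is `1 - q^{μ_j}`; this is where `μ_j ≠ 0` is needed.
  have hden : c ^ n * L ≤ ‖∏ i, (1 - u * s i * q ^ ((k i : ℤ) - (k (i + 1) : ℤ)))‖ := by
    rw [norm_prod, hLdef]
    calc c ^ n * ∏ i, max 1 (‖q‖ ^ ((k i : ℤ) - (k (i + 1) : ℤ)))
        = ∏ i, c * max 1 (‖q‖ ^ ((k i : ℤ) - (k (i + 1) : ℤ))) := by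
          rw [Finset.prod_mul_distrib, Finset.prod_const, Finset.card_univ, Fintype.card_fin]
      _ ≤ _ := by
          refine Finset.prod_le_prod (fun _ _ => by positivity) fun i _ => ?_
          have := hP.le_norm_one_sub i j ((k i : ℤ) - (k (i + 1) : ℤ)) (by rintro rfl; exact hj)
          rwa [div_eq_inv_mul] at this
  have hfin : c ^ n * L * ‖MvPowerSeries.coeff k f‖ ≤ L * ((n + 1) * A ^ n * (h₁ + h₂)) := by
    calc c ^ n * L * ‖MvPowerSeries.coeff k f‖
        ≤ ‖(∏ i, (1 - u * s i * q ^ ((k i : ℤ) - (k (i + 1) : ℤ)))) * MvPowerSeries.coeff k f‖ := by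
          rw [norm_mul]; gcongr
      _ ≤ (n + 1) * (A ^ n * h₂) + A ^ n * (L * h₁) := by
          rw [hmain]; exact (norm_sub_le _ _).trans (add_le_add hψ hR)
      _ ≤ L * ((n + 1) * (A ^ n * h₂)) + L * ((n + 1) * (A ^ n * h₁)) := by
          refine add_le_add (le_mul_of_one_le_left (by positivity) hL1) ?_
          have h1 : L * (A ^ n * h₁) ≤ L * ((n + 1) * (A ^ n * h₁)) := by
            refine mul_le_mul_of_nonneg_left (le_mul_of_one_le_left (by positivity) ?_)
              (by positivity)
            linarith [Nat.cast_nonneg (α := ℝ) n]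
          linarith
      _ = _ := by ring
  have hL0 : 0 < L := by linarith
  rw [div_mul_eq_mul_div, le_div_iff₀ (by positivity)]
  refine le_of_mul_le_mul_left ?_ hL0
  linarith

end ParameterBounds

theorem exists_coeff_bounds {A c : ℝ} (hA : 1 ≤ A) (hc : 0 < c) :
    ∃ w : ℝ, 0 < w ∧ w < 1 ∧ ∀ (s : Fin n → ℂ) (q t : ℂ), ParameterBounds A c s q t →
      ∀ (f : Series n) (ε : ℕ → PowerSeries ℂ), IsNormalizedFormalSolution s q t f ε →
        (∀ k, ‖MvPowerSeries.coeff k f‖ * w ^ k.degree ≤ 2) ∧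
        ∀ r ∈ Finset.Icc 1 n, ∀ m : ℕ,
          ‖PowerSeries.coeff m (ε r)‖ * (w ^ n) ^ m ≤ 2 ^ n * A ^ n + 1 := by
  have hA0 : 0 < A := by linarith
  set C : ℝ := (n + 1) * A ^ n / c ^ n with hC
  have hC0 : 0 < C := by positivity
  set D : ℝ := 2 ^ n * (A ^ n * (4 ^ (n * n) * 4 ^ (n * n))) with hD
  have hD1 : 1 ≤ D := by
    refine one_le_mul_of_one_le_of_one_le (one_le_pow₀ (by norm_num))
      (one_le_mul_of_one_le_of_one_le (one_le_pow₀ hA)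
        (one_le_mul_of_one_le_of_one_le ?_ ?_)) <;> exact one_le_pow₀ (by norm_num)
  -- The linear and quadratic terms contribute `2δ + 4δ = 6δ`; this choice gives `6 (C + 1) δ = 1`,
  -- hence `1 + 6Cδ ≤ 2`.
  set lam : ℝ := (6 * (C + 1) * D)⁻¹ with hlam
  have hl0 : 0 < lam := by positivity
  have hl1 : lam ≤ 1 := inv_le_one_of_one_le₀ (by nlinarith)
  set w₀ : ℝ := (16 * A)⁻¹ with hw₀
  have hw₀0 : 0 < w₀ := by positivity
  have hw₀A : 16 * A * w₀ ≤ 1 := (mul_inv_cancel₀ (by positivity)).le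
  have hw₀1 : w₀ < 1 := inv_lt_one_of_one_lt₀ (by linarith)
  set w : ℝ := lam * w₀ / A with hwdef
  have hw : A * w = lam * w₀ := by rw [hwdef]; field_simp
  have hw0 : 0 < w := by positivity
  have hw1 : w < 1 := by nlinarith
  refine ⟨w, hw0, hw1, fun s q t hP f ε H => ?_⟩
  set δ : ℝ := 2 ^ n * (A ^ n * (lam * (4 ^ (n * n) * 4 ^ (n * n)))) with hδ
  have hδ' : 6 * (C + 1) * δ = 1 := by
    have : δ = lam * D := by rw [hδ, hD]; ring
    rw [this, hlam]
    field_simp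
  have hδ0 : 0 < δ := by positivity
  have hB := fun N => hP.wnorm_majorantB_le hA hw₀0.le hw₀A hl0.le hl1 hw N
  have hf0 : MvPowerSeries.coeff 0 f = 1 := by
    rw [H.coeff_of_const (by simp), if_pos rfl]
  have hlow : ∀ N, wnorm w N f ≤ 2 → wnorm w (N + 1) (lowerMajorant s q t f) ≤ δ * 2 := by
    intro N hN
    refine (wnorm_succ_mul_le hw0.le N _ _ (coeff_zero_majorantB s q t)).trans ?_
    rw [wnorm_absSeries]
    exact mul_le_mul (hB _) hN (wnorm_nonneg hw0.le _ _) hδ0.le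
  have hS : ∀ N, wnorm w N f ≤ 2 := by
    intro N
    induction N with
    | zero =>
      have : exponents n 0 = {0} := by
        ext k
        rw [mem_exponents, Nat.le_zero, Finsupp.degree_eq_zero_iff, Finset.mem_singleton]
      simp [wnorm, this, hf0]
    | succ N ih =>
      have h1 := hlow N ih
      have h2 : wnorm w (N + 1) (lowerMajorant s q t f * absSeries f) ≤ δ * 2 * 2 := by
        refine (wnorm_succ_mul_le hw0.le N _ _ (coeff_zero_lowerMajorant s q t f)).trans ?_
        rw [wnorm_absSeries]
        exact mul_le_mul h1 ih (wnorm_nonneg hw0.le _ _) (by positivity)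
      have hnn := coeff_lowerMajorant_nonneg s q t f
      have hnn' : ∀ k, 0 ≤ MvPowerSeries.coeff k (lowerMajorant s q t f * absSeries f) :=
        coeff_mul_nonneg hnn (coeff_absSeries_nonneg f)
      have h3 : wnorm w (N + 1) f ≤ wnorm w (N + 1) (1 : Series n) +
          C * (wnorm w (N + 1) (lowerMajorant s q t f) +
            wnorm w (N + 1) (lowerMajorant s q t f * absSeries f)) := by
        classical
        simp only [wnorm]
        rw [← Finset.sum_add_distrib, Finset.mul_sum, ← Finset.sum_add_distrib]
        refine Finset.sum_le_sum fun k _ => ?_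
        rw [← add_mul, ← mul_assoc, ← add_mul, Real.norm_of_nonneg (hnn k),
          Real.norm_of_nonneg (hnn' k), MvPowerSeries.coeff_one]
        refine mul_le_mul_of_nonneg_right ?_ (by positivity)
        by_cases hk : k = 0
        · rw [if_pos hk, norm_one, hk, hf0, norm_one]
          exact le_add_of_nonneg_right
            (mul_nonneg hC0.le (add_nonneg (hnn 0) (hnn' 0)))
        · rw [if_neg hk, norm_zero, zero_add]
          exact hP.norm_coeff_le hA hc H hk
      have h4 := wnorm_one_le (n := n) (𝕜 := ℂ) hw0.le (N + 1)
      have h5 := mul_le_mul_of_nonneg_left (add_le_add h1 h2) hC0.le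
      nlinarith
  refine ⟨fun k => ?_, fun r hr m => ?_⟩
  · refine le_trans ?_ (hS k.degree)
    exact Finset.single_le_sum
      (f := fun k : Fin n →₀ ℕ => ‖MvPowerSeries.coeff k f‖ * w ^ k.degree)
      (fun _ _ => by positivity) (mem_exponents.2 le_rfl)
  · classical
    set k : Fin n →₀ ℕ := Finsupp.equivFunOnFinite.symm fun _ : Fin n => m with hk
    have hki : ∀ i, k i = m := fun i => rfl
    -- The monomial `p^m` has degree `n m` in `z`, whence the radius `w ^ n` for the eigenvalues.
    have hdeg : k.degree = n * m := by simp [Finsupp.degree_eq_sum, hki]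
    have hcoef : MvPowerSeries.coeff k (ofNome (ε r) : Series n) = PowerSeries.coeff m (ε r) :=
      if_pos fun i => rfl
    have h1 := H.norm_coeff_eigenvalue_sub_le hP.q_ne_zero hP.norm_q_lt_one hr k
    rw [map_sub, hcoef, MvPowerSeries.coeff_C] at h1
    set e : ℂ := ∑ I : Finset (Fin n) with I.card = r, ∏ i ∈ I, s i with he
    have he' : ‖e‖ ≤ 2 ^ n * A ^ n := by
      refine (norm_sum_le_of_le _ fun I _ => hP.norm_prod_s_le hA I).trans ?_
      rw [Finset.sum_const, nsmul_eq_mul]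
      gcongr
      have := Finset.card_le_univ (Finset.univ.filter fun I : Finset (Fin n) => I.card = r)
      rw [Fintype.card_finset, Fintype.card_fin] at this
      exact_mod_cast this
    have h2 : ‖(if k = 0 then e else 0)‖ ≤ 2 ^ n * A ^ n := by
      split_ifs
      · exact he'
      · rw [norm_zero]; positivity
    have h3 : MvPowerSeries.coeff k (lowerMajorant s q t f) * w ^ k.degree ≤ 1 := by
      have h4 := Finset.single_le_sum (s := exponents n (k.degree + 1))
        (f := fun k : Fin n →₀ ℕ =>
          ‖MvPowerSeries.coeff k (lowerMajorant s q t f)‖ * w ^ k.degree)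
        (fun _ _ => by positivity) (mem_exponents.2 (Nat.le_succ k.degree))
      have h5 := hlow k.degree (hS _)
      simp only [wnorm] at h5
      rw [Real.norm_of_nonneg (coeff_lowerMajorant_nonneg s q t f k)] at h4
      nlinarith
    have h6 : w ^ k.degree ≤ 1 := pow_le_one₀ hw0.le hw1.le
    rw [← pow_mul, ← hdeg]
    have h7 : ‖PowerSeries.coeff m (ε r)‖ ≤ 2 ^ n * A ^ n +
        MvPowerSeries.coeff k (lowerMajorant s q t f) := by
      have := norm_le_norm_add_norm_sub' (PowerSeries.coeff m (ε r)) (if k = 0 then e else 0)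
      linarith
    calc _ ≤ (2 ^ n * A ^ n + MvPowerSeries.coeff k (lowerMajorant s q t f)) * w ^ k.degree := by
          gcongr
      _ = 2 ^ n * A ^ n * w ^ k.degree +
          MvPowerSeries.coeff k (lowerMajorant s q t f) * w ^ k.degree := add_mul _ _ _
      _ ≤ _ := add_le_add (mul_le_of_le_one_right (by positivity) h6) h3

end Solution

/-! ### Nondegeneracy constants on compact parameter sets -/

section Parameters

open Filter Topology

/-- For large `m` the term `α q^m` is uniformly at most 1/2; the finitely many remaining `m` are
handled by compactness. -/
theorem eventually_forall_le_norm_one_sub_mul_pow {X : Type*} [TopologicalSpace X] {K : Set X}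
    (hK : IsCompact K) {α q : X → ℂ} (hα : ContinuousOn α K) (hq : ContinuousOn q K)
    (hq1 : ∀ P ∈ K, ‖q P‖ < 1) (S : Set ℕ) (hS : ∀ P ∈ K, ∀ m ∈ S, α P * q P ^ m ≠ 1) :
    ∀ᶠ c : ℝ in 𝓝[>] 0, ∀ P ∈ K, ∀ m ∈ S, c ≤ ‖1 - α P * q P ^ m‖ := by
  obtain ⟨B, hB⟩ := hK.exists_bound_of_continuousOn hα
  obtain ⟨b, hb, hb'⟩ := hK.exists_forall_le' (f := fun P => 1 - ‖q P‖) (a := 0)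
    (continuousOn_const.sub hq.norm) fun P hP => sub_pos.2 (hq1 P hP)
  -- For empty `K` the constant `b` may exceed 1; the maximum keeps the base nonnegative.
  have hlim : Tendsto (fun m : ℕ => B * (max (1 - b) 0) ^ m) atTop (𝓝 (B * 0)) :=
    (tendsto_pow_atTop_nhds_zero_of_lt_one (le_max_right _ _)
      (max_lt (by linarith) one_pos)).const_mul B
  rw [mul_zero] at hlim
  obtain ⟨M, hM⟩ := eventually_atTop.1 (hlim.eventually
    (gt_mem_nhds (show (0 : ℝ) < 1 / 2 by norm_num)))
  have hsmall : ∀ᶠ c : ℝ in 𝓝[>] 0, ∀ m ∈ Finset.range M, ∀ P ∈ K, m ∈ S →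
      c ≤ ‖1 - α P * q P ^ m‖ := by
    rw [Filter.eventually_all_finset]
    intro m _
    by_cases hm : m ∈ S
    · obtain ⟨a, ha, ha'⟩ := hK.exists_forall_le' (f := fun P => ‖1 - α P * q P ^ m‖) (a := 0)
        (continuousOn_const.sub (hα.mul (hq.pow m))).norm
        fun P hP => norm_pos_iff.2 (sub_ne_zero.2 (hS P hP m hm).symm)
      filter_upwards [Ioo_mem_nhdsGT ha] with c hc P hP _ using hc.2.le.trans (ha' P hP)
    · exact Eventually.of_forall fun c P _ h => absurd h hm
  filter_upwards [hsmall, Ioo_mem_nhdsGT (show (0 : ℝ) < 1 / 2 by norm_num)] with c hc hc2 P hP m hm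
  rcases lt_or_ge m M with h | h
  · exact hc m (Finset.mem_range.2 h) P hP hm
  · have h1 : ‖α P * q P ^ m‖ ≤ 1 / 2 := by
      rw [norm_mul, norm_pow]
      refine le_trans ?_ (hM m h).le
      have h2 := hB P hP
      have h3 : ‖q P‖ ≤ max (1 - b) 0 := le_max_of_le_left (by linarith [hb' P hP])
      have h4 := (norm_nonneg _).trans h2
      gcongr
    have h2 := norm_sub_norm_le 1 (α P * q P ^ m)
    rw [norm_one] at h2
    linarith [hc2.2]

/-- For `m = -l ≤ 0`, factoring out `α q^{-l}` leaves `1 - α⁻¹ q^l` and accounts for the growth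
`|q|^m`. The set `S` allows `m = 0` to be excluded when `α = 1`. -/
theorem eventually_forall_le_norm_one_sub_mul_zpow {X : Type*} [TopologicalSpace X] {K : Set X}
    (hK : IsCompact K) {α q : X → ℂ} (hα : ContinuousOn α K) (hα0 : ∀ P ∈ K, α P ≠ 0)
    (hq : ContinuousOn q K) (hq0 : ∀ P ∈ K, q P ≠ 0) (hq1 : ∀ P ∈ K, ‖q P‖ < 1) (S : Set ℤ)
    (hS : ∀ P ∈ K, ∀ m ∈ S, α P * q P ^ m ≠ 1) :
    ∀ᶠ c : ℝ in 𝓝[>] 0, ∀ P ∈ K, ∀ m ∈ S,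
      c * max 1 (‖q P‖ ^ m) ≤ ‖1 - α P * q P ^ m‖ := by
  have e : ∀ P ∈ K, ∀ l : ℕ,
      1 - α P * q P ^ (-(l : ℤ)) = -(q P ^ (-(l : ℤ)) * α P * (1 - (α P)⁻¹ * q P ^ l)) := by
    intro P hP l
    have h1 := hα0 P hP
    have h2 := pow_ne_zero l (hq0 P hP)
    rw [zpow_neg, zpow_natCast]
    field_simp
    ring
  have hpos := eventually_forall_le_norm_one_sub_mul_pow hK hα hq hq1 {m : ℕ | (m : ℤ) ∈ S}
    fun P hP m hm => by simpa using hS P hP m hm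
  have hneg := eventually_forall_le_norm_one_sub_mul_pow hK (hα.inv₀ hα0) hq hq1
    {m : ℕ | -(m : ℤ) ∈ S} fun P hP m hm h => by
      refine hS P hP _ hm ?_
      have h1 := e P hP m
      simp only [Pi.inv_apply] at h
      rw [h, sub_self, mul_zero, neg_zero] at h1
      exact (sub_eq_zero.1 h1).symm
  obtain ⟨c₀, hc₀, hc₀'⟩ := (hneg.and self_mem_nhdsWithin).exists
  obtain ⟨a, ha, ha'⟩ := hK.exists_forall_le' (f := fun P => ‖α P‖) (a := 0) hα.norm
    fun P hP => norm_pos_iff.2 (hα0 P hP)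
  filter_upwards [hpos, Ioo_mem_nhdsGT (mul_pos ha hc₀')] with c hc hc2 P hP m hm
  have hqP : 0 < ‖q P‖ := norm_pos_iff.2 (hq0 P hP)
  rcases le_total 0 m with h | h
  · obtain ⟨l, rfl⟩ := Int.eq_ofNat_of_zero_le h
    rw [zpow_natCast, zpow_natCast, max_eq_left (pow_le_one₀ hqP.le (hq1 P hP).le), mul_one]
    exact hc P hP l hm
  · obtain ⟨l, hl⟩ := Int.eq_ofNat_of_zero_le (neg_nonneg.2 h)
    obtain rfl : m = -(l : ℤ) := by omega
    have h1 : 1 ≤ ‖q P‖ ^ (-(l : ℤ)) := by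
      rw [zpow_neg, zpow_natCast]
      exact (one_le_inv₀ (by positivity)).2 (pow_le_one₀ hqP.le (hq1 P hP).le)
    rw [max_eq_right h1, e P hP l, norm_neg, norm_mul, norm_mul, norm_zpow]
    have h2 : c₀ ≤ ‖1 - (α P)⁻¹ * q P ^ l‖ := hc₀ P hP l hm
    have h3 := ha' P hP
    have h4 : a * c₀ ≤ ‖α P‖ * ‖1 - (α P)⁻¹ * q P ^ l‖ :=
      mul_le_mul h3 h2 (le_of_lt hc₀') (norm_nonneg _)
    rw [mul_assoc, mul_comm]
    gcongr
    exact hc2.2.le.trans h4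

theorem exists_parameterBounds {n : ℕ} {K : Set ((Fin n → ℂ) × ℂ × ℂ)}
    (hKD : K ⊆ parameterDomain n) (hK : IsCompact K) :
    ∃ A c : ℝ, 1 ≤ A ∧ 0 < c ∧ ∀ P ∈ K, ParameterBounds A c P.1 P.2.1 P.2.2 := by
  have hs : ∀ i, ContinuousOn (fun P : (Fin n → ℂ) × ℂ × ℂ => P.1 i) K := fun i => by fun_prop
  have hq : ContinuousOn (fun P : (Fin n → ℂ) × ℂ × ℂ => P.2.1) K := by fun_prop
  have ht : ContinuousOn (fun P : (Fin n → ℂ) × ℂ × ℂ => P.2.2) K := by fun_prop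
  have hs0 : ∀ i, ∀ P ∈ K, P.1 i ≠ 0 := fun i P hP => (hKD hP).1 i
  have hq0 : ∀ P ∈ K, P.2.1 ≠ 0 := fun P hP => (hKD hP).2.1
  have hq1 : ∀ P ∈ K, ‖P.2.1‖ < 1 := fun P hP => (hKD hP).2.2.1
  have ht0 : ∀ P ∈ K, P.2.2 ≠ 0 := fun P hP => (hKD hP).2.2.2.1
  obtain ⟨B, hB⟩ := hK.exists_bound_of_continuousOn
    -- Bundling the parameters and their inverses into one map gives all bounds at once, by the sup
    -- norm.
    (f := fun P => (P, P.2.1⁻¹, P.2.2⁻¹, fun i => (P.1 i)⁻¹))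
    (continuousOn_id.prodMk ((hq.inv₀ hq0).prodMk ((ht.inv₀ ht0).prodMk
      (continuousOn_pi.2 fun i => (hs i).inv₀ (hs0 i)))))
  have hden : ∀ᶠ c : ℝ in 𝓝[>] 0, ∀ i j : Fin n, ∀ P ∈ K, ∀ m ∈ {m : ℤ | i = j → m ≠ 0},
      c * max 1 (‖P.2.1‖ ^ m) ≤ ‖1 - P.1 i / P.1 j * P.2.1 ^ m‖ := by
    rw [eventually_all]
    intro i
    rw [eventually_all]
    intro j
    refine eventually_forall_le_norm_one_sub_mul_zpow hK ((hs i).div (hs j) (hs0 j))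
      (fun P hP => div_ne_zero (hs0 i P hP) (hs0 j P hP)) hq hq0 hq1 _ fun P hP m hm h => ?_
    have hi := hs0 i P hP
    have hj := hs0 j P hP
    have hqP := hq0 P hP
    have hdom := (hKD hP).2.2.2.2
    have h1 : P.1 i / P.1 j = P.2.1 ^ (-m) := by
      rw [zpow_neg]
      exact eq_inv_of_mul_eq_one_left h
    rcases lt_trichotomy i j with hij | hij | hij
    · exact hdom i j hij m (by rw [← inv_div, h1, zpow_neg, inv_inv])
    · subst hij
      rw [div_self hi] at h1
      have h2 := congrArg norm h1
      rw [norm_one, norm_zpow, eq_comm,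
        zpow_eq_one_iff_right₀ (norm_nonneg _) (hq1 P hP).ne] at h2
      exact hm rfl (neg_eq_zero.1 h2)
    · exact hdom j i hij _ h1
  obtain ⟨c, hc, hc0⟩ := (hden.and self_mem_nhdsWithin).exists
  refine ⟨max B 1, c, le_max_right _ _, hc0, fun P hP => ?_⟩
  have h0 := (hB P hP).trans (le_max_left B 1)
  simp only [Prod.norm_def, sup_le_iff] at h0
  obtain ⟨⟨h1, h2, h3⟩, h4, h5, h6⟩ := h0
  have hpos : (0 : ℝ) ≤ max B 1 := zero_le_one.trans (le_max_right _ _)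
  exact
    { q_ne_zero := hq0 P hP
      norm_q_lt_one := hq1 P hP
      norm_q_inv_le := by rwa [← norm_inv]
      s_ne_zero := fun i => hs0 i P hP
      norm_s_le := (pi_norm_le_iff_of_nonneg hpos).1 h1
      norm_s_inv_le := (pi_norm_le_iff_of_nonneg hpos).1 h6
      norm_t_le := h3
      norm_t_inv_le := h5
      le_norm_one_sub := fun i j m hm => hc i j P hP m hm }

end Parameters

/-! ### Convergence from the coefficient bounds -/

/-- Any finite set of exponents lies in a box, over which the sum is a product of `n` partial
geometric sums. -/
theorem summable_pow_degree {n : ℕ} {x : ℝ} (hx : 0 ≤ x) (hx1 : x < 1) :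
    Summable fun k : Fin n →₀ ℕ => x ^ k.degree := by
  classical
  have h : Summable fun k : Fin n → ℕ => ∏ i, x ^ k i := by
    refine summable_of_sum_le (c := ∏ _i : Fin n, (1 - x)⁻¹)
      (fun k => Finset.prod_nonneg fun _ _ => by positivity) fun S => ?_
    let M : ℕ := ∑ k ∈ S, ∑ i, k i
    have hS : S ⊆ Fintype.piFinset fun _ : Fin n => Finset.range (M + 1) := by
      intro k hk
      rw [Fintype.mem_piFinset]
      intro i
      rw [Finset.mem_range, Nat.lt_succ_iff]
      exact (Finset.single_le_sum (f := k) (fun _ _ => Nat.zero_le _) (Finset.mem_univ i)).trans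
        (Finset.single_le_sum (f := fun k : Fin n → ℕ => ∑ i, k i) (fun _ _ => Nat.zero_le _) hk)
    refine (Finset.sum_le_sum_of_subset_of_nonneg hS fun k _ _ =>
      Finset.prod_nonneg fun _ _ => by positivity).trans ?_
    rw [← Finset.prod_univ_sum]
    refine Finset.prod_le_prod (fun _ _ => by positivity) fun i _ => ?_
    rw [← tsum_geometric_of_lt_one hx hx1]
    exact (summable_geometric_of_lt_one hx hx1).sum_le_tsum _ fun _ _ => by positivity
  refine (Finsupp.equivFunOnFinite.summable_iff.2 h).congr fun k => ?_
  simp [Finsupp.degree_eq_sum, Finset.prod_pow_eq_pow_sum]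

theorem norm_term_le {n : ℕ} [NeZero n] {f : Series n} {w ρ : ℝ} (hw : 0 < w)
    (hf : ∀ k, ‖MvPowerSeries.coeff k f‖ * w ^ k.degree ≤ 2) {p : ℂ} {x : Fin n → ℂ}
    (hx : ∀ i, ‖zValue p x i‖ ≤ ρ) (k : Fin n →₀ ℕ) :
    ‖term f p x k‖ ≤ 2 * (ρ / w) ^ k.degree := by
  have hz : ∏ i, ‖zValue p x i‖ ^ k i ≤ ρ ^ k.degree := by
    rw [Finsupp.degree_eq_sum, ← Finset.prod_pow_eq_pow_sum]
    exact Finset.prod_le_prod (fun _ _ => by positivity) fun i _ =>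
      pow_le_pow_left₀ (norm_nonneg _) (hx i) _
  have hρ : 0 ≤ ρ := (norm_nonneg _).trans (hx 0)
  rw [term, norm_mul, norm_prod]
  simp only [norm_pow]
  calc _ ≤ ‖MvPowerSeries.coeff k f‖ * ρ ^ k.degree := by gcongr
    _ = ‖MvPowerSeries.coeff k f‖ * w ^ k.degree * (ρ / w) ^ k.degree := by
        rw [div_pow]; field_simp
    _ ≤ _ := by gcongr; exact hf k

theorem summableUniformlyOn_of_norm_le {ι β : Type*} {F : ι → β → ℝ} {u : ι → ℝ} {S : Set β}
    (hu : Summable u) (h : ∀ i, ∀ b ∈ S, ‖F i b‖ ≤ u i) : SummableUniformlyOn F S :=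
  (HasSumUniformlyOn.of_norm_le_summable hu h).summableUniformlyOn

theorem exists_summableUniformlyOn {n : ℕ} [NeZero n] {K : Set ((Fin n → ℂ) × ℂ × ℂ)}
    (hKD : K ⊆ parameterDomain n) (hK : IsCompact K) :
    ∃ σ : ℝ, 0 < σ ∧ σ < 1 ∧
      ∀ (F : (Fin n → ℂ) × ℂ × ℂ → Series n) (E : (Fin n → ℂ) × ℂ × ℂ → ℕ → PowerSeries ℂ),
        (∀ P ∈ K, IsNormalizedFormalSolution P.1 P.2.1 P.2.2 (F P) (E P)) →
        (∀ ρ : ℝ, ρ < σ →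
          SummableUniformlyOn
            (fun (k : Fin n →₀ ℕ) (a : ((Fin n → ℂ) × ℂ × ℂ) × ℂ × (Fin n → ℂ)) =>
              ‖term (F a.1) a.2.1 a.2.2 k‖)
            {a | a.1 ∈ K ∧ (∀ i, a.2.2 i ≠ 0) ∧ ∀ i, ‖zValue a.2.1 a.2.2 i‖ ≤ ρ}) ∧
        (∀ r ∈ Finset.Icc 1 n, ∀ ρ : ℝ, ρ < σ ^ n →
          SummableUniformlyOn
            (fun (k : ℕ) (a : ((Fin n → ℂ) × ℂ × ℂ) × ℂ) =>
              ‖PowerSeries.coeff k (E a.1 r) * a.2 ^ k‖)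
            {a | a.1 ∈ K ∧ ‖a.2‖ ≤ ρ}) := by
  obtain ⟨A, c, hA, hc, hP⟩ := exists_parameterBounds hKD hK
  obtain ⟨w, hw0, hw1, hw⟩ := exists_coeff_bounds (n := n) hA hc
  refine ⟨w, hw0, hw1, fun F E H => ⟨fun ρ hρ => ?_, fun r hr ρ hρ => ?_⟩⟩
  · rcases lt_or_ge ρ 0 with hneg | hnn
    · refine summableUniformlyOn_of_norm_le summable_zero fun k a ha => ?_
      exact absurd ((norm_nonneg _).trans (ha.2.2 0)) (not_le.2 hneg)
    · refine summableUniformlyOn_of_norm_le ((summable_pow_degree (n := n) (div_nonneg hnn hw0.le)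
        ((div_lt_one hw0).2 hρ)).mul_left 2) fun k a ha => ?_
      rw [norm_norm]
      exact norm_term_le hw0 (hw _ _ _ (hP _ ha.1) _ _ (H _ ha.1)).1 ha.2.2 k
  · rcases lt_or_ge ρ 0 with hneg | hnn
    · refine summableUniformlyOn_of_norm_le summable_zero fun k a ha => ?_
      exact absurd ((norm_nonneg _).trans ha.2) (not_le.2 hneg)
    · have hwn : 0 < w ^ n := by positivity
      refine summableUniformlyOn_of_norm_le ((summable_geometric_of_lt_one (div_nonneg hnn hwn.le)
        ((div_lt_one hwn).2 hρ)).mul_left (2 ^ n * A ^ n + 1)) fun k a ha => ?_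
      have h1 := (hw _ _ _ (hP _ ha.1) _ _ (H _ ha.1)).2 r hr k
      rw [norm_norm, norm_mul, norm_pow]
      calc _ ≤ ‖PowerSeries.coeff k (E a.1 r)‖ * ρ ^ k := by
            have := ha.2
            gcongr
        _ = ‖PowerSeries.coeff k (E a.1 r)‖ * (w ^ n) ^ k * (ρ / w ^ n) ^ k := by
            rw [div_pow]; field_simp
        _ ≤ _ := by gcongr

end Ruijsenaars

end

open Ruijsenaars in
theorem theorem2p6 (n : ℕ) [NeZero n] :
    (∀ (s : Fin n → ℂ) (q t : ℂ), (s, q, t) ∈ parameterDomain n →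
      ∃ σ : ℝ, 0 < σ ∧ σ < 1 ∧
        ∀ (f : Series n) (ε : ℕ → PowerSeries ℂ), IsNormalizedFormalSolution s q t f ε →
          (∀ (p : ℂ) (x : Fin n → ℂ), ‖p‖ < σ ^ n → (∀ i, x i ≠ 0) →
            (∀ i, ‖zValue p x i‖ < σ) →
            Summable fun k : Fin n →₀ ℕ => ‖term f p x k‖) ∧
          (∀ r ∈ Finset.Icc 1 n, ∀ p : ℂ, ‖p‖ < σ ^ n →
            Summable fun k : ℕ => ‖PowerSeries.coeff k (ε r) * p ^ k‖)) ∧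
    (∀ K : Set ((Fin n → ℂ) × ℂ × ℂ), K ⊆ parameterDomain n → IsCompact K →
      ∃ σ : ℝ, 0 < σ ∧ σ < 1 ∧
        ∀ (F : (Fin n → ℂ) × ℂ × ℂ → Series n) (E : (Fin n → ℂ) × ℂ × ℂ → ℕ → PowerSeries ℂ),
          (∀ P ∈ K, IsNormalizedFormalSolution P.1 P.2.1 P.2.2 (F P) (E P)) →
          (∀ ρ : ℝ, ρ < σ →
            SummableUniformlyOn
              (fun (k : Fin n →₀ ℕ) (a : ((Fin n → ℂ) × ℂ × ℂ) × ℂ × (Fin n → ℂ)) =>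
                ‖term (F a.1) a.2.1 a.2.2 k‖)
              {a | a.1 ∈ K ∧ (∀ i, a.2.2 i ≠ 0) ∧ ∀ i, ‖zValue a.2.1 a.2.2 i‖ ≤ ρ}) ∧
          (∀ r ∈ Finset.Icc 1 n, ∀ ρ : ℝ, ρ < σ ^ n →
            SummableUniformlyOn
              (fun (k : ℕ) (a : ((Fin n → ℂ) × ℂ × ℂ) × ℂ) =>
                ‖PowerSeries.coeff k (E a.1 r) * a.2 ^ k‖)
              {a | a.1 ∈ K ∧ ‖a.2‖ ≤ ρ})) := by
  refine ⟨fun s q t hP => ?_, fun K hKD hK => exists_summableUniformlyOn hKD hK⟩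
  obtain ⟨σ, h0, h1, hσ⟩ := exists_summableUniformlyOn (Set.singleton_subset_iff.2 hP)
    isCompact_singleton
  refine ⟨σ, h0, h1, fun f ε H => ?_⟩
  obtain ⟨hf, hε⟩ := hσ (fun _ => f) (fun _ => ε) (by rintro P rfl; exact H)
  refine ⟨fun p x _ hx hz => ?_, fun r hr p hp => ?_⟩
  -- The largest `|z_i|` is still below `σ` and serves as `ρ` in the uniform statement for a single
  -- parameter point.
  · obtain ⟨i, -, hi⟩ := Finset.exists_max_image Finset.univ (fun i => ‖zValue p x i‖)
      ⟨0, Finset.mem_univ _⟩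
    exact (hf _ (hz i)).summable (x := ((s, q, t), p, x))
      ⟨rfl, hx, fun j => hi j (Finset.mem_univ j)⟩
  · exact (hε r hr _ hp).summable (x := ((s, q, t), p)) ⟨rfl, le_rfl⟩
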